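/- A \emph{$k$-thin representation} of a finite simple graph $G=(V,E)$ consists of an ordering $v_1<\dots<v_n$ of $V$ and a partition of $V$ into $k$ (possibly empty) classes $V^1,\dots,V^k$ such that, whenever $a<b<c$, $v_a,v_b$ are in the same class and $v_cv_a\in E$, also $v_cv_b\in E$. Fix integers $k,r,p\ge 0$ and a polynomial $q$. Consider the following optimization problem. An instance consists of: a $k$-thin representation of a graph $G$ on $n$ vertices; any number $t$ of nonnegative rational weight functions $w_1,\dots,w_t$ on $V$, rational coefficients $c_{ij}$ ($1\le i\le t$, $1\le j\le r$), and the choice between minimization and maximization; weight functions $b_1,\dots,b_p:V\to\mathbb{Z}_{\ge 0}$ with values at most $q(n)$; for each vertex $v$ a list $L(v)$ of subsets of $\{1,\dots,r\}$; a symmetric $r\times r$ matrix $M$ over $\{0,1,*\}$; and, for each $1\le i\le p$ and $J\subseteq\{1,\dots,r\}$, bounds $l_{iJ\cap},l_{iJ\cup}\in\mathbb{Z}_{\ge 0}$ and $u_{iJ\cap},u_{iJ\cup}\in\mathbb{Z}_{\ge 0}\cup\{\infty\}$. The task is to find sets $S_1,\dots,S_r\subseteq V$ (not necessarily disjoint)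 that minimize, respectively maximize, $\sum_{i,j}c_{ij}\,w_i(S_j)$, where $w_i(S)=\sum_{v\in S}w_i(v)$, subject to the following conditions, or to report that no sets satisfy them: \begin{itemize} \item $\{j: v\in S_j\}\in L(v)$ for every $v\in V$; \item for all $i,j$ (including $i=j$): if $M_{ij}=1$, then any two distinct vertices $u\in S_i$, $v\in S_j$ are adjacent; if $M_{ij}=0$, then no vertex of $S_i$ is adjacent to a vertex of $S_j$ (so $S_i$ is a clique if $M_{ii}=1$ and a stable set if $M_{ii}=0$); \item $l_{iJ\cap}\le b_i\big(\bigcap_{j\in J}S_j\big)\le u_{iJ\cap}$ and $l_{iJ\cup}\le b_i\big(\bigcup_{j\in J}S_j\big)\le u_{iJ\cup}$ for all $i$ and $J$, where the intersection over $J=\emptyset$ is $V$. \end{itemize} Then the following hold. \begin{enumerate} \item For all fixed $k,r,p,q$ this problem can be solved in time polynomial in the length of the encoding of the instance (numbers written in binary). \item For all fixed $k,m$ the family includes the list matrix partition problems: given a $k$-thin representation of $G$, a symmetric $m\times m$ matrix $M$ over $\{0,1,*\}$, lists $L(v)\subseteq\{1,\dots,m\}$, and any objective as above (with $r=m$), there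 is an instance with $r=m$, $p=0$, the same representation and the same objective, whose feasible families $(S_1,\dots,S_m)$ are exactly the partitions of $V$ into $m$ (possibly empty) parts that put each vertex into a part on its list and satisfy the adjacency conditions given by $M$. Finding such a partition, or reporting that there is none, takes time polynomial in the length of the encoding of the representation, $M$ and the lists. \item For all fixed $k,s$ the family likewise includes colouring with $s$ colours: given a $k$-thin representation of $G$ and any objective as above (with $r=s$), there is an instance with $r=s$, $p=0$, the same representation and the same objective, whose feasible families are exactly the families of (possibly empty) colour classes of the proper $s$-colourings of $G$. Given the representation, an $s$-colouring can be found, or reported not to exist, in polynomial time. \end{enumerate} -/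

import Mathlib

/-! ### A cost model for computation

Data are finite binary trees whose leaves are either empty or carry a rational number written in
binary. Programs are built from projections, pairing, constants, case distinctions, rational
arithmetic and comparison, and loops over lists. Executing an instruction costs the total size
(bit length) of its input and of its output, plus the cost of the instructions it calls. Each
instruction only needs time polynomial in the sizes it is charged for on a Turing machine, so a
program with polynomially bounded cost is a polynomial-time algorithm in the usual sense (and there
are no instructions for unbounded search, so every program terminates). -/

namespace Thin

inductive Data : Type
  | nil : Data
  | num (a : ℚ) : Data
  | cons (x y : Data) : Data

namespace Data

/-- Number of symbols needed to write down a datum; numbers are written in binary, as a reduced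
fraction. -/
def size : Data → ℕ
  | nil => 1
  | num a => 1 + Nat.size a.num.natAbs + Nat.size a.den
  | cons x y => 1 + x.size + y.size

def fst : Data → Data
  | cons x _ => x
  | _ => nil

def snd : Data → Data
  | cons _ y => y
  | _ => nil

/-- The rational number at a leaf (`0` for all other data). -/
def val : Data → ℚ
  | num a => a
  | _ => 0

/-- `num 1` for a number, `nil` for all other data. -/
def isNum : Data → Data
  | num _ => num 1
  | _ => nil

/-- Left fold of `step` over the entries `a₁, a₂, …` of the list `cons a₁ (cons a₂ …)`. -/
def fold (step : Data → Data → Data) : Data → Data → Data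
  | cons a l, s => fold step l (step a s)
  | _, s => s

/-- Total cost of the steps executed by `fold step`, when one step costs `cost`. -/
def foldCost (step : Data → Data → Data) (cost : Data → Data → ℕ) : Data → Data → ℕ
  | cons a l, s => cost a s + foldCost step cost l (step a s)
  | _, _ => 0

end Data

inductive Prog : Type
  | id : Prog
  | const (d : Data) : Prog
  | fst : Prog
  | snd : Prog
  | pair (f g : Prog) : Prog
  | comp (g f : Prog) : Prog
  | ifNil (c f g : Prog) : Prog
  | isNum : Prog
  | add : Prog
  | sub : Prog
  | mul : Prog
  | le : Prog
  | loop (f : Prog) : Prog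

namespace Prog

/-- The output of a program. Binary arithmetic takes its operands as a pair; `loop f` takes a pair
of a list and an initial state, and for each entry `a` of the list in turn replaces the state `s` by
the output of `f` on the pair of `a` and `s`. -/
def run : Prog → Data → Data
  | id, x => x
  | const d, _ => d
  | fst, x => x.fst
  | snd, x => x.snd
  | pair f g, x => .cons (f.run x) (g.run x)
  | comp g f, x => g.run (f.run x)
  | ifNil c f g, x =>
      match c.run x with
      | .nil => f.run x
      | _ => g.run x
  | isNum, x => x.isNum
  | add, x => .num (x.fst.val + x.snd.val)
  | sub, x => .num (x.fst.val - x.snd.val)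
  | mul, x => .num (x.fst.val * x.snd.val)
  | le, x => if x.fst.val ≤ x.snd.val then .num 1 else .nil
  | loop f, x => Data.fold (fun a s => f.run (.cons a s)) x.fst x.snd

/-- The running time of a program. -/
def time : Prog → Data → ℕ
  | pair f g, x => x.size + ((pair f g).run x).size + (f.time x + g.time x)
  | comp g f, x => x.size + ((comp g f).run x).size + (f.time x + g.time (f.run x))
  | ifNil c f g, x => x.size + ((ifNil c f g).run x).size + c.time x +
      match c.run x with
      | .nil => f.time x
      | _ => g.time x
  | loop f, x => x.size + ((loop f).run x).size +
      Data.foldCost (fun a s => f.run (.cons a s)) (fun a s => f.time (.cons a s)) x.fst x.snd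
  | p, x => x.size + (p.run x).size

end Prog

/-- A search problem: for each instance find a solution or report that there is none. -/
structure SearchProblem where
  Inst : Type
  Cand : Inst → Type
  IsSol : (x : Inst) → Cand x → Prop
  encInst : Inst → Data
  encCand : (x : Inst) → Cand x → Data

/-- Some program returns, on (the encoding of) every instance, a solution if there is one and `nil`
otherwise, in time bounded by a polynomial in the length of the encoding of the instance. -/
def SearchProblem.PolyTimeSolvable (Q : SearchProblem) : Prop :=
  ∃ (P : Prog) (T : Polynomial ℕ), ∀ x : Q.Inst,
    P.time (Q.encInst x) ≤ T.eval (Q.encInst x).size ∧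
    ((∃ y : Q.Cand x, Q.IsSol x y ∧ P.run (Q.encInst x) = .cons (.num 1) (Q.encCand x y)) ∨
      ((∀ y : Q.Cand x, ¬ Q.IsSol x y) ∧ P.run (Q.encInst x) = .nil))

/-! ### Encodings -/

namespace Data

/-- The list `cons x₁ (cons x₂ … nil)`. -/
def ofList : List Data → Data
  | [] => nil
  | x :: l => cons x (ofList l)

def ofFn {m : ℕ} (f : Fin m → Data) : Data := ofList (List.ofFn f)

open Classical in
/-- Truth values are encoded by `1` and `0`. -/
noncomputable def ofProp (P : Prop) : Data := if P then num 1 else num 0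

/-- Characteristic vector of a set. -/
noncomputable def ofSet {m : ℕ} (s : Finset (Fin m)) : Data := ofFn fun i => ofProp (i ∈ s)

/-- The list of the values of a function at all `2 ^ r` subsets of an `r`-element set, in a fixed
order. -/
def ofFamily {r : ℕ} (f : Finset (Fin r) → Data) : Data :=
  ofList (((List.finRange r).sublists.map List.toFinset).map f)

open Classical in
/-- `nil` stands for `∞`. -/
noncomputable def ofENat (u : ℕ∞) : Data := if u = ⊤ then nil else num (u.toNat : ℚ)

end Data

/-! ### Thin representations and the framework -/

/-- A `k`-thin representation: a graph on `v₁ < ⋯ < vₙ` (the elements of `Fin n` in their natural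
order) and a partition of its vertices into `k` (possibly empty) classes, consistent with the
order. -/
structure ThinRep (k : ℕ) where
  n : ℕ
  G : SimpleGraph (Fin n)
  cls : Fin n → Fin k
  consistent : ∀ a b c : Fin n, a < b → b < c → cls a = cls b → G.Adj c a → G.Adj c b

/-- Entries of a matrix over `0, 1, *`. -/
inductive Entry : Type
  | zero : Entry
  | one : Entry
  | star : Entry

/-- The sets `S j` obey the adjacency conditions `M`. For `i = j` these conditions say that `S i`
is a stable set (`M i i = 0`), respectively a clique (`M i i = 1`). -/
def Respects {n r : ℕ} (G : SimpleGraph (Fin n)) (M : Matrix (Fin r) (Fin r) Entry)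
    (S : Fin r → Finset (Fin n)) : Prop :=
  ∀ i j : Fin r,
    (M i j = .one → ∀ u ∈ S i, ∀ v ∈ S j, u ≠ v → G.Adj u v) ∧
    (M i j = .zero → ∀ u ∈ S i, ∀ v ∈ S j, ¬ G.Adj u v)

/-- A linear objective: nonnegative weights `w₁, …, wₜ` on the vertices, coefficients `c i j`, and
the direction of optimization. -/
structure Objective {k : ℕ} (R : ThinRep k) (r : ℕ) where
  t : ℕ
  w : Fin t → Fin R.n → ℚ
  w_nonneg : ∀ i v, 0 ≤ w i v
  c : Fin t → Fin r → ℚ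
  maximize : Bool

/-- An instance of the framework on a given `k`-thin representation, with `r` sets and `p` integer
weight functions; `u = ∞` means that there is no upper bound. -/
structure Instance {k : ℕ} (R : ThinRep k) (r p : ℕ) extends Objective R r where
  b : Fin p → Fin R.n → ℕ
  L : Fin R.n → Finset (Finset (Fin r))
  M : Matrix (Fin r) (Fin r) Entry
  M_symm : M.IsSymm
  lowerInter : Fin p → Finset (Fin r) → ℕ
  upperInter : Fin p → Finset (Fin r) → ℕ∞
  lowerUnion : Fin p → Finset (Fin r) → ℕ
  upperUnion : Fin p → Finset (Fin r) → ℕ∞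

/-- The value of the objective: the sum of `c i j * w i (S j)`. -/
def Objective.value {k r : ℕ} {R : ThinRep k} (O : Objective R r)
    (S : Fin r → Finset (Fin R.n)) : ℚ :=
  ∑ i : Fin O.t, ∑ j : Fin r, O.c i j * ∑ v ∈ S j, O.w i v

/-- Intersection of the sets `S j`, `j ∈ J` (all vertices if `J` is empty). -/
def inter {n r : ℕ} (S : Fin r → Finset (Fin n)) (J : Finset (Fin r)) : Finset (Fin n) :=
  Finset.univ.filter fun v => ∀ j ∈ J, v ∈ S j

/-- Union of the sets `S j`, `j ∈ J`. -/
def union {n r : ℕ} (S : Fin r → Finset (Fin n)) (J : Finset (Fin r)) : Finset (Fin n) :=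
  Finset.univ.filter fun v => ∃ j ∈ J, v ∈ S j

namespace Instance

variable {k r p : ℕ} {R : ThinRep k}

structure Feasible (I : Instance R r p) (S : Fin r → Finset (Fin R.n)) : Prop where
  lists : ∀ v : Fin R.n, (Finset.univ.filter fun j => v ∈ S j) ∈ I.L v
  adjacency : Respects R.G I.M S
  inter_bounds : ∀ (i : Fin p) (J : Finset (Fin r)),
    I.lowerInter i J ≤ ∑ v ∈ inter S J, I.b i v ∧
      ((∑ v ∈ inter S J, I.b i v : ℕ) : ℕ∞) ≤ I.upperInter i J
  union_bounds : ∀ (i : Fin p) (J : Finset (Fin r)),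
    I.lowerUnion i J ≤ ∑ v ∈ union S J, I.b i v ∧
      ((∑ v ∈ union S J, I.b i v : ℕ) : ℕ∞) ≤ I.upperUnion i J

def Optimal (I : Instance R r p) (S : Fin r → Finset (Fin R.n)) : Prop :=
  I.Feasible S ∧ ∀ S' : Fin r → Finset (Fin R.n), I.Feasible S' →
    if I.maximize then I.value S' ≤ I.value S else I.value S ≤ I.value S'

end Instance

/-- Adjacency matrix and class of each vertex. -/
noncomputable def ThinRep.enc {k : ℕ} (R : ThinRep k) : Data :=
  .cons (.ofFn fun u => .ofFn fun v => .ofProp (R.G.Adj u v))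
    (.ofFn fun v => .num ((R.cls v : ℕ) : ℚ))

def Entry.enc : Entry → Data
  | .zero => .num 0
  | .one => .num 1
  | .star => .nil

def encMatrix {r : ℕ} (M : Matrix (Fin r) (Fin r) Entry) : Data :=
  .ofFn fun i => .ofFn fun j => (M i j).enc

noncomputable def Instance.enc {k r p : ℕ} {R : ThinRep k} (I : Instance R r p) : Data :=
  .ofList
    [R.enc,
      .ofFn fun i => .ofFn fun v => .num (I.w i v),
      .ofFn fun i => .ofFn fun j => .num (I.c i j),
      .ofProp (I.maximize = true),
      .ofFn fun i => .ofFn fun v => .num (I.b i v : ℚ),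
      .ofFn fun v => .ofFamily fun J => .ofProp (J ∈ I.L v),
      encMatrix I.M,
      .ofFn fun i => .ofFamily fun J => .num (I.lowerInter i J : ℚ),
      .ofFn fun i => .ofFamily fun J => .ofENat (I.upperInter i J),
      .ofFn fun i => .ofFamily fun J => .num (I.lowerUnion i J : ℚ),
      .ofFn fun i => .ofFamily fun J => .ofENat (I.upperUnion i J)]

/-- Families of sets are encoded by their characteristic vectors. -/
noncomputable def encSets {n r : ℕ} (S : Fin r → Finset (Fin n)) : Data :=
  .ofFn fun j => .ofSet (S j)

/-- The framework problem for fixed `k`, `r`, `p` and a fixed polynomial `q` that bounds the integer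
weights: find an optimal family of sets. -/
noncomputable def frameworkProblem (k r p : ℕ) (q : Polynomial ℕ) : SearchProblem where
  Inst := { x : Σ R : ThinRep k, Instance R r p // ∀ i v, x.2.b i v ≤ q.eval x.1.n }
  Cand x := Fin r → Finset (Fin x.1.1.n)
  IsSol x S := x.1.2.Optimal S
  encInst x := x.1.2.enc
  encCand _ S := encSets S

/-! ### List matrix partitions and colourings -/

/-- Data of a list matrix partition problem with a symmetric `m × m` matrix over `0, 1, *`. -/
structure ListMatrix {k : ℕ} (R : ThinRep k) (m : ℕ) where
  M : Matrix (Fin m) (Fin m) Entry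
  M_symm : M.IsSymm
  L : Fin R.n → Finset (Fin m)

/-- The parts of the partition of the vertices given by a map to the set of (names of) parts. -/
def parts {n m : ℕ} (f : Fin n → Fin m) (j : Fin m) : Finset (Fin n) :=
  Finset.univ.filter fun v => f v = j

/-- `f` assigns each vertex to a part on its list so that the parts obey `M`. -/
def ListMatrix.IsPartition {k m : ℕ} {R : ThinRep k} (P : ListMatrix R m)
    (f : Fin R.n → Fin m) : Prop :=
  (∀ v, f v ∈ P.L v) ∧ Respects R.G P.M (parts f)

noncomputable def listMatrixProblem (k m : ℕ) : SearchProblem where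
  Inst := Σ R : ThinRep k, ListMatrix R m
  Cand x := Fin x.1.n → Fin m
  IsSol x f := x.2.IsPartition f
  encInst x := .ofList [x.1.enc, encMatrix x.2.M, .ofFn fun v => .ofSet (x.2.L v)]
  encCand _ f := encSets (parts f)

/-- Colouring with `s` colours, given a `k`-thin representation. -/
noncomputable def colouringProblem (k s : ℕ) : SearchProblem where
  Inst := ThinRep k
  Cand R := R.G.Coloring (Fin s)
  IsSol _ _ := True
  encInst R := R.enc
  encCand _ C := encSets (parts fun v => C v)

end Thin

/-!
Polynomial time for the framework is obtained from a dynamic program over the vertices, taken from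
the last to the first. A partial solution fixes, for the vertices `u, u + 1, …`, the set of names
of the parts that contain them (their types). Two facts make this work.

* Of a partial solution, the earlier vertices only notice, for each part `i`, which of them have a
  neighbour in the part (`touched`) and which of them are adjacent to all of it (`dominating`);
  the bounds only notice the weights collected so far. These data form the `signature`, and two
  partial solutions with the same signature have the same extensions (`validFrom_congr`,
  `signature_congr`), so that it suffices to keep a best one for each signature.
* By consistency, if a vertex is adjacent to a later vertex `v`, so is every vertex of the same
  class between it and `v`. Hence the sets `touched` and `dominating` are closed upwards within each
  class and are given by one threshold per class (`exists_threshold`); as the weights are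
  polynomially bounded, there are polynomially many signatures (`length_le_of_nodup_signature`).

The correctness of such a dynamic program is `Stages.solution_spec`. That it runs in polynomial time
in the cost model is shown without writing programs explicitly. `Computes e g` says that a program
computes `g i` from the environment `e i` in polynomial time, uniformly in `i`. The class of these
functions is closed under case distinction, arithmetic, and recursion on lists as long as the
intermediate results have polynomial size (`Computes.foldr`). Variables bound by a quantifier, sum
or recursion are treated by a change of environment: what is asked for the body is asked for in
every environment from which the old environment and the new variable can be computed.

List matrix partitions are the instances in which all lists consist of singletons, and colourings
are the list matrix partitions with zeros on the diagonal and stars elsewhere.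
-/

namespace Thin

/-! ### Polynomial bounds and programs -/

theorem eval_le_eval (T : Polynomial ℕ) {a b : ℕ} (h : a ≤ b) : T.eval a ≤ T.eval b := by
  simp only [Polynomial.eval_eq_sum_range]
  gcongr

/-- `f` is bounded by a polynomial in the size of the environment `e`. -/
def PolyBdd {ι : Type} (e : ι → Data) (f : ι → ℕ) : Prop :=
  ∃ T : Polynomial ℕ, ∀ i, f i ≤ T.eval (e i).size

/-- From the environment `e i` some program computes `g i`, in time polynomial in the size of
`e i`; neither the program nor the polynomial depends on the index `i`. Nothing is said about inputs
that are not of the form `e i`, so that restrictions on the inputs can be put into the choice of the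
index type. -/
def Computes {ι : Type} (e g : ι → Data) : Prop :=
  ∃ P : Prog, (∀ i, P.run (e i) = g i) ∧ PolyBdd e fun i => P.time (e i)

namespace PolyBdd

variable {ι κ : Type} {e : ι → Data} {f g : ι → ℕ}

theorem mono (hg : PolyBdd e g) (h : ∀ i, f i ≤ g i) : PolyBdd e f := by
  obtain ⟨T, hT⟩ := hg
  exact ⟨T, fun i => (h i).trans (hT i)⟩

theorem const (c : ℕ) : PolyBdd e fun _ => c := ⟨Polynomial.C c, fun i => by simp⟩

theorem size : PolyBdd e fun i => (e i).size := ⟨Polynomial.X, fun i => by simp⟩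

theorem add (hf : PolyBdd e f) (hg : PolyBdd e g) : PolyBdd e fun i => f i + g i := by
  obtain ⟨S, hS⟩ := hf
  obtain ⟨T, hT⟩ := hg
  exact ⟨S + T, fun i => by simpa using add_le_add (hS i) (hT i)⟩

theorem mul (hf : PolyBdd e f) (hg : PolyBdd e g) : PolyBdd e fun i => f i * g i := by
  obtain ⟨S, hS⟩ := hf
  obtain ⟨T, hT⟩ := hg
  exact ⟨S * T, fun i => by simpa using Nat.mul_le_mul (hS i) (hT i)⟩

theorem pow (hf : PolyBdd e f) (c : ℕ) : PolyBdd e fun i => f i ^ c := by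
  obtain ⟨S, hS⟩ := hf
  exact ⟨S ^ c, fun i => by simpa using Nat.pow_le_pow_left (hS i) c⟩

theorem eval (hf : PolyBdd e f) (T : Polynomial ℕ) : PolyBdd e fun i => T.eval (f i) := by
  obtain ⟨S, hS⟩ := hf
  exact ⟨T.comp S, fun i => by simpa using eval_le_eval T (hS i)⟩

theorem lift (hf : PolyBdd e f) {e' : κ → Data} {φ : κ → ι}
    (h : PolyBdd e' fun x => (e (φ x)).size) : PolyBdd e' fun x => f (φ x) := by
  obtain ⟨S, hS⟩ := hf
  exact (h.eval S).mono fun x => hS (φ x)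

end PolyBdd

/-- Running times bound output sizes, so that what is computable in polynomial time has polynomial
size. -/
theorem Prog.size_le_time (P : Prog) (x : Data) : x.size + (P.run x).size ≤ P.time x := by
  cases P <;> simp only [Prog.time] <;> omega

namespace Computes

variable {ι κ : Type} {e g h : ι → Data}

theorem polyBdd_size (hg : Computes e g) : PolyBdd e fun i => (g i).size := by
  obtain ⟨P, hP, hT⟩ := hg
  refine hT.mono fun i => ?_
  have := P.size_le_time (e i)
  rw [hP] at this
  omega

theorem congr (hg : Computes e g) (h' : ∀ i, g i = h i) : Computes e h := by
  rwa [← funext h']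

theorem id : Computes e e :=
  ⟨Prog.id, fun _ => rfl, (PolyBdd.size.add PolyBdd.size).mono fun i => by
    simp [Prog.time, Prog.run]⟩

theorem const (d : Data) : Computes e fun _ => d :=
  ⟨Prog.const d, fun _ => rfl, (PolyBdd.size.add (.const d.size)).mono fun i => by
    simp [Prog.time, Prog.run]⟩

theorem trans (hg : Computes e g) (hh : Computes g h) : Computes e h := by
  have hs := hg.polyBdd_size
  obtain ⟨P, hP, hT⟩ := hg
  obtain ⟨Q, hQ, hU⟩ := hh
  refine ⟨.comp Q P, fun i => by simp [Prog.run, hP, hQ], ?_⟩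
  have hU' := hU.lift (φ := fun i => i) hs
  refine ((PolyBdd.size.add hU').add (hT.add hU')).mono fun i => ?_
  have := Q.size_le_time (g i)
  simp only [Prog.time, Prog.run, hP]
  omega

theorem comap (hg : Computes e g) (φ : κ → ι) :
    Computes (fun x => e (φ x)) (fun x => g (φ x)) := by
  obtain ⟨P, hP, T, hT⟩ := hg
  exact ⟨P, fun x => hP _, T, fun x => hT _⟩

/-- What is computable from an environment is computable from every environment from which that
environment can be computed. -/
theorem lift (hg : Computes e g) {e' : κ → Data} {φ : κ → ι}
    (he : Computes e' fun x => e (φ x)) : Computes e' fun x => g (φ x) :=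
  he.trans (hg.comap φ)

theorem pair (hg : Computes e g) (hh : Computes e h) :
    Computes e fun i => .cons (g i) (h i) := by
  have h1 := hg.polyBdd_size
  have h2 := hh.polyBdd_size
  obtain ⟨P, hP, hT⟩ := hg
  obtain ⟨Q, hQ, hU⟩ := hh
  refine ⟨.pair P Q, fun i => by simp [Prog.run, hP, hQ], ?_⟩
  refine (((PolyBdd.size.add (.const 1)).add (h1.add h2)).add (hT.add hU)).mono fun i => ?_
  simp only [Prog.time, Prog.run, hP, hQ, Data.size]
  omega

theorem fst (hg : Computes e g) : Computes e fun i => (g i).fst :=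
  hg.trans ⟨.fst, fun _ => rfl, (PolyBdd.size.add PolyBdd.size).mono fun i => by
    simp only [Prog.time, Prog.run]
    cases g i <;> simp [Data.fst, Data.size] <;> omega⟩

theorem snd (hg : Computes e g) : Computes e fun i => (g i).snd :=
  hg.trans ⟨.snd, fun _ => rfl, (PolyBdd.size.add PolyBdd.size).mono fun i => by
    simp only [Prog.time, Prog.run]
    cases g i <;> simp [Data.snd, Data.size]
    omega⟩

open Classical in
theorem ifNil {c : ι → Data} (hc : Computes e c) (hg : Computes e g) (hh : Computes e h) :
    Computes e fun i => if c i = .nil then g i else h i := by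
  have h1 := hg.polyBdd_size
  have h2 := hh.polyBdd_size
  obtain ⟨R, hR, hV⟩ := hc
  obtain ⟨P, hP, hT⟩ := hg
  obtain ⟨Q, hQ, hU⟩ := hh
  have key (i : ι) : (Prog.ifNil R P Q).run (e i) = if c i = .nil then g i else h i := by
    simp only [Prog.run, hR, hP, hQ]
    cases c i <;> simp
  refine ⟨.ifNil R P Q, key, ?_⟩
  refine (((PolyBdd.size.add h1).add h2).add ((hV.add hT).add hU)).mono fun i => ?_
  simp only [Prog.time, key, hR]
  cases c i <;> simp <;> omega

end Computes

/-! ### Rational arithmetic -/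

theorem natSize_mul_le (a b : ℕ) : Nat.size (a * b) ≤ Nat.size a + Nat.size b := by
  rw [Nat.size_le, pow_add]
  exact Nat.mul_lt_mul'' (Nat.lt_size_self a) (Nat.lt_size_self b)

theorem natSize_add_le (a b : ℕ) : Nat.size (a + b) ≤ max (Nat.size a) (Nat.size b) + 1 := by
  rw [Nat.size_le, pow_succ]
  have h1 := (Nat.lt_size_self a).trans_le
    (Nat.pow_le_pow_right (n := 2) (by norm_num) (le_max_left a.size b.size))
  have h2 := (Nat.lt_size_self b).trans_le
    (Nat.pow_le_pow_right (n := 2) (by norm_num) (le_max_right a.size b.size))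
  omega

theorem natSize_le_self (a : ℕ) : Nat.size a ≤ a := by
  rw [Nat.size_le]
  exact Nat.lt_two_pow_self

theorem size_num_mul_le (a b : ℚ) :
    (Data.num (a * b)).size ≤ (Data.num a).size + (Data.num b).size := by
  have h1 : (a * b).num.natAbs ≤ a.num.natAbs * b.num.natAbs := by
    rw [Rat.mul_num, ← Int.natAbs_mul]
    exact Int.natAbs_ediv_le_natAbs _ _
  have h2 : (a * b).den ≤ a.den * b.den :=
    Nat.le_of_dvd (Nat.mul_pos a.den_pos b.den_pos) (Rat.mul_den_dvd a b)
  have h3 := (Nat.size_le_size h1).trans (natSize_mul_le _ _)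
  have h4 := (Nat.size_le_size h2).trans (natSize_mul_le _ _)
  simp only [Data.size]
  omega

/-- The larger of the lengths of numerator and denominator, plus one. Unlike `Data.size` it is
subadditive, so that it controls sums of arbitrarily many terms. -/
def ratLength (a : ℚ) : ℕ := max (Nat.size a.num.natAbs) (Nat.size a.den) + 1

theorem size_num_le_ratLength (a : ℚ) : (Data.num a).size ≤ 2 * ratLength a := by
  simp only [Data.size, ratLength]
  omega

theorem ratLength_le_size_num (a : ℚ) : ratLength a ≤ (Data.num a).size := by
  simp only [Data.size, ratLength]
  omega

theorem ratLength_add_le (a b : ℚ) : ratLength (a + b) ≤ ratLength a + ratLength b := by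
  have h1 : (a + b).num.natAbs ≤ a.num.natAbs * b.den + b.num.natAbs * a.den := by
    have h : (a + b).num.natAbs ≤ (a.num * b.den + b.num * a.den).natAbs := by
      rw [Rat.add_def, Rat.normalize_eq]
      exact Int.natAbs_ediv_le_natAbs _ _
    refine h.trans ((Int.natAbs_add_le _ _).trans ?_)
    simp [Int.natAbs_mul]
  have h2 : (a + b).den ≤ a.den * b.den :=
    Nat.le_of_dvd (Nat.mul_pos a.den_pos b.den_pos) (Rat.add_den_dvd a b)
  have h3 := (Nat.size_le_size h1).trans (natSize_add_le _ _)
  have h4 := (Nat.size_le_size h2).trans (natSize_mul_le _ _)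
  have h5 := natSize_mul_le a.num.natAbs b.den
  have h6 := natSize_mul_le b.num.natAbs a.den
  simp only [ratLength]
  omega

theorem size_num_natCast_le (a : ℕ) : (Data.num (a : ℚ)).size ≤ a + 2 := by
  have := natSize_le_self a
  simp [Data.size]
  omega

namespace Computes

variable {ι κ : Type} {e : ι → Data} {f g : ι → Data}

theorem add (hf : Computes e f) (hg : Computes e g) :
    Computes e fun i => .num ((f i).val + (g i).val) := by
  refine (hf.pair hg).trans ⟨.add, fun _ => rfl, ?_⟩
  refine (PolyBdd.size.add ((PolyBdd.const 2).mul (PolyBdd.size.add (.const 8)))).mono fun i => ?_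
  have h1 := ratLength_add_le (f i).val (g i).val
  have h2 := size_num_le_ratLength ((f i).val + (g i).val)
  have h3 (d : Data) : ratLength d.val ≤ d.size + 1 := by
    cases d with
    | num a => exact (ratLength_le_size_num a).trans (Nat.le_succ _)
    | _ => simp [Data.val, ratLength, Data.size] <;> omega
  have h4 := h3 (f i)
  have h5 := h3 (g i)
  simp only [Prog.time, Prog.run, Data.fst, Data.snd]
  simp only [Data.size] at *
  omega

theorem size_num_val_le (d : Data) : (Data.num d.val).size ≤ d.size + 1 := by
  cases d <;> simp [Data.val, Data.size]
  omega

theorem mul (hf : Computes e f) (hg : Computes e g) :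
    Computes e fun i => .num ((f i).val * (g i).val) := by
  refine (hf.pair hg).trans ⟨.mul, fun _ => rfl, ?_⟩
  refine (PolyBdd.size.add (PolyBdd.size.add (.const 8))).mono fun i => ?_
  have h2 := size_num_mul_le (f i).val (g i).val
  have h4 := size_num_val_le (f i)
  have h5 := size_num_val_le (g i)
  simp only [Prog.time, Prog.run, Data.fst, Data.snd]
  simp only [Data.size] at *
  omega

theorem le (hf : Computes e f) (hg : Computes e g) :
    Computes e fun i => if (f i).val ≤ (g i).val then .num 1 else .nil := by
  refine (hf.pair hg).trans ⟨.le, fun _ => rfl, ?_⟩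
  refine (PolyBdd.size.add (.const 3)).mono fun i => ?_
  simp only [Prog.time, Prog.run, Data.fst, Data.snd]
  have h : ∀ q : Prop, [Decidable q] → (if q then Data.num 1 else Data.nil).size ≤ 3 := by
    intro q _
    split_ifs <;> simp [Data.size]
  exact Nat.add_le_add_left (h _) _

end Computes

/-! ### Recursion on lists -/

namespace Data

theorem fold_ofList (step : Data → Data → Data) (l : List Data) (s : Data) :
    fold step (ofList l) s = l.foldl (fun s a => step a s) s := by
  induction l generalizing s with
  | nil => rfl
  | cons a l ih => exact ih _

theorem fold_ofList_append (step : Data → Data → Data) (l l' : List Data) (s : Data) :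
    fold step (ofList (l ++ l')) s = fold step (ofList l') (fold step (ofList l) s) := by
  simp only [fold_ofList, List.foldl_append]

theorem foldCost_ofList_append (step : Data → Data → Data) (cost : Data → Data → ℕ)
    (l l' : List Data) (s : Data) :
    foldCost step cost (ofList (l ++ l')) s =
      foldCost step cost (ofList l) s +
        foldCost step cost (ofList l') (fold step (ofList l) s) := by
  induction l generalizing s with
  | nil => simp [ofList, foldCost, fold]
  | cons a l ih =>
    simp only [List.cons_append, ofList, foldCost, fold, ih]
    omega

theorem size_pos (d : Data) : 1 ≤ d.size := by
  cases d <;> simp only [size] <;> omega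

theorem size_le_size_ofList {l : List Data} {a : Data} (h : a ∈ l) :
    a.size ≤ (ofList l).size := by
  induction l with
  | nil => simp at h
  | cons b l ih =>
    simp only [ofList, size]
    rcases List.mem_cons.1 h with rfl | h
    · omega
    · have := ih h
      omega

theorem length_le_size_ofList (l : List Data) : l.length ≤ (ofList l).size := by
  induction l with
  | nil => simp
  | cons a l ih =>
    simp only [ofList, size, List.length_cons]
    omega

theorem size_ofList_le_of_sublist {l l' : List Data} (h : l.Sublist l') :
    (ofList l).size ≤ (ofList l').size := by
  induction h with
  | slnil => exact le_rfl
  | cons a _ ih => simp only [ofList, size]; omega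
  | cons_cons a _ ih => simp only [ofList, size]; omega

theorem size_ofList_le_mul (l : List Data) (B : ℕ) (h : ∀ a ∈ l, a.size ≤ B) :
    (ofList l).size ≤ 1 + l.length * (1 + B) := by
  induction l with
  | nil => simp [ofList, size]
  | cons a l ih =>
    have h1 := h a List.mem_cons_self
    have h2 := ih fun b hb => h b (List.mem_cons_of_mem _ hb)
    simp only [ofList, size, List.length_cons, Nat.succ_mul]
    omega

end Data

/-- The code of a list, given codes of its entries. -/
def encList {α : Type} (enc : α → Data) (l : List α) : Data := .ofList (l.map enc)

@[simp] theorem encList_nil {α : Type} (enc : α → Data) : encList enc [] = .nil := rfl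

@[simp] theorem encList_cons {α : Type} (enc : α → Data) (a : α) (l : List α) :
    encList enc (a :: l) = .cons (enc a) (encList enc l) := rfl

theorem size_encList_append {α : Type} (enc : α → Data) (l l' : List α) :
    (encList enc (l ++ l')).size ≤ (encList enc l).size + (encList enc l').size := by
  induction l with
  | nil => simp
  | cons a l ih => simp only [List.cons_append, encList_cons, Data.size]; omega

theorem size_encList_le_of_sublist {α : Type} {enc : α → Data} {l l' : List α}
    (h : l.Sublist l') : (encList enc l).size ≤ (encList enc l').size :=
  Data.size_ofList_le_of_sublist (h.map enc)

theorem size_le_size_encList {α : Type} {enc : α → Data} {l : List α} {a : α} (h : a ∈ l) :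
    (enc a).size ≤ (encList enc l).size :=
  Data.size_le_size_ofList (List.mem_map_of_mem h)

theorem length_le_size_encList {α : Type} (enc : α → Data) (l : List α) :
    l.length ≤ (encList enc l).size := by
  have h := Data.length_le_size_ofList (l.map enc)
  rwa [List.length_map] at h

namespace Computes

variable {ι α β : Type} {e g h : ι → Data}

/-- Loops fold from the front; the reversal turns them into recursions on the list. -/
theorem reverse {l : ι → List Data} (hl : Computes e fun i => .ofList (l i)) :
    Computes e fun i => .ofList (l i).reverse := by
  have key (l : List Data) (s : Data) :
      (Data.fold Data.cons (.ofList l) s).size ≤ (Data.ofList l).size + s.size ∧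
      Data.foldCost Data.cons (fun a s => Prog.id.time (.cons a s)) (.ofList l) s ≤
        l.length * (2 * ((Data.ofList l).size + s.size)) := by
    induction l generalizing s with
    | nil => simp [Data.ofList, Data.foldCost, Data.fold]
    | cons a l ih =>
      obtain ⟨h1, h2⟩ := ih (.cons a s)
      simp only [Data.ofList, Data.foldCost, Data.fold, Data.size, List.length_cons,
        Nat.succ_mul, Prog.time, Prog.run] at *
      refine ⟨by omega, ?_⟩
      rw [add_comm]
      refine add_le_add (h2.trans (Nat.mul_le_mul_left _ ?_)) ?_ <;> omega
  have hrun (i : ι) : (Prog.loop .id).run (.cons (.ofList (l i)) .nil) =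
      Data.fold Data.cons (.ofList (l i)) .nil := rfl
  refine (hl.pair (const .nil)).trans ⟨.loop .id, fun i => ?_, ?_⟩
  · rw [hrun, Data.fold_ofList]
    have (m m' : List Data) : m.foldl (fun s a => Data.cons a s) (.ofList m') =
        .ofList (m.reverse ++ m') := by
      induction m generalizing m' with
      | nil => rfl
      | cons a m ih => rw [List.reverse_cons, List.append_assoc]; exact ih (a :: m')
    exact (this (l i) []).trans (by rw [List.append_nil])
  · refine ((PolyBdd.size.add PolyBdd.size).add
      (PolyBdd.size.mul ((PolyBdd.const 2).mul PolyBdd.size))).mono fun i => ?_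
    obtain ⟨h1, h2⟩ := key (l i) .nil
    have h3 := Data.length_le_size_ofList (l i)
    simp only [Prog.time, hrun]
    simp only [Prog.run, Data.fst, Data.snd]
    refine add_le_add (add_le_add le_rfl (h1.trans ?_)) (h2.trans (Nat.mul_le_mul ?_ ?_)) <;>
      simp only [Data.size] <;> omega

/-- A fold over a list is computable if a step is and if all intermediate results have polynomial
size. The step has to be computable in every environment that provides the current entry, the
current result and the original environment; the entry and the result may be assumed to be ones
which occur. -/
theorem foldr {encA : α → Data} {encB : β → Data} {l : ι → List α} {s : ι → β}
    {f : ι → α → β → β} (hl : Computes e fun i => encList encA (l i))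
    (hs : Computes e fun i => encB (s i))
    (hf : ∀ {κ : Type} {e' : κ → Data} (φ : κ → ι) (a : κ → α) (t : κ → List α) (b : κ → β),
      (∀ x, (a x :: t x) <:+ l (φ x)) → (∀ x, b x = (t x).foldr (f (φ x)) (s (φ x))) →
      Computes e' (fun x => e (φ x)) → Computes e' (fun x => encA (a x)) →
      Computes e' (fun x => encB (b x)) → Computes e' fun x => encB (f (φ x) (a x) (b x)))
    (hb : ∃ B : ι → ℕ, PolyBdd e B ∧
      ∀ i t, t <:+ l i → (encB (t.foldr (f i) (s i))).size ≤ B i) :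
    Computes e fun i => encB ((l i).foldr (f i) (s i)) := by
  -- The step is compiled for the environments that occur: entry, result for the rest of the list,
  -- and the original environment, which the loop has to carry along.
  let K := {x : ι × α × List α // (x.2.1 :: x.2.2) <:+ l x.1}
  let st : K → β := fun x => x.1.2.2.foldr (f x.1.1) (s x.1.1)
  let e' : K → Data := fun x => .cons (encA x.1.2.1) (.cons (encB (st x)) (e x.1.1))
  have h0 : Computes e' e' := id
  have he : Computes e' fun x => e x.1.1 := h0.snd.snd
  obtain ⟨Q, hQ, T, hT⟩ := (hf (fun x : K => x.1.1) (fun x => x.1.2.1) (fun x => x.1.2.2) st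
    (fun x => x.2) (fun _ => rfl) he h0.fst h0.snd.fst).pair he
  obtain ⟨B, hB, hBs⟩ := hb
  have hl' := hl.reverse
  have hls := hl.polyBdd_size
  have key (i : ι) (t : List α) (ht : t <:+ l i) :
      Data.fold (fun a s => Q.run (.cons a s)) (.ofList (t.map encA).reverse)
        (.cons (encB (s i)) (e i)) = .cons (encB (t.foldr (f i) (s i))) (e i) := by
    induction t with
    | nil => rfl
    | cons a t ih =>
      rw [List.map_cons, List.reverse_cons, Data.fold_ofList_append,
        ih ((List.suffix_cons a t).trans ht)]
      exact hQ ⟨(i, a, t), ht⟩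
  have cost (i : ι) (t : List α) (ht : t <:+ l i) :
      Data.foldCost (fun a s => Q.run (.cons a s)) (fun a s => Q.time (.cons a s))
        (.ofList (t.map encA).reverse) (.cons (encB (s i)) (e i)) ≤
      t.length * T.eval ((encList encA (l i)).size + (B i + (e i).size + 2)) := by
    induction t with
    | nil => simp [Data.ofList, Data.foldCost]
    | cons a t ih =>
      have ht' := (List.suffix_cons a t).trans ht
      rw [List.map_cons, List.reverse_cons, Data.foldCost_ofList_append, key i t ht',
        List.length_cons, Nat.succ_mul]
      refine add_le_add (ih ht') ?_
      refine (hT ⟨(i, a, t), ht⟩).trans (eval_le_eval T ?_)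
      have h1 := size_le_size_encList (enc := encA) (ht.mem List.mem_cons_self)
      have h2 := hBs i t ht'
      simp only [e', st, Data.size]
      omega
  have main : Computes (fun i => .cons (.ofList ((l i).map encA).reverse)
      (.cons (encB (s i)) (e i)))
      (fun i => .cons (encB ((l i).foldr (f i) (s i))) (e i)) := by
    refine ⟨.loop Q, fun i => ?_, ?_⟩
    · exact key i (l i) List.suffix_rfl
    · let e'' : ι → Data := fun i =>
        .cons (.ofList ((l i).map encA).reverse) (.cons (encB (s i)) (e i))
      have hsz : PolyBdd e'' fun i => (e i).size := PolyBdd.size.mono fun i => by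
        simp only [e'', Data.size]
        omega
      have hB' := hB.lift (φ := fun i => i) hsz
      have hls' := hls.lift (φ := fun i => i) hsz
      refine ((PolyBdd.size.add ((PolyBdd.const 1).add (hB'.add hsz))).add
        (hls'.mul ((hls'.add ((hB'.add hsz).add (.const 2))).eval T))).mono fun i => ?_
      have hr : (Prog.loop Q).run (e'' i) = .cons (encB ((l i).foldr (f i) (s i))) (e i) :=
        key i (l i) List.suffix_rfl
      have h1 := hBs i (l i) List.suffix_rfl
      have h2 := (cost i (l i) List.suffix_rfl).trans
        (Nat.mul_le_mul_right _ (length_le_size_encList encA (l i)))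
      simp only [Prog.time]
      rw [hr]
      refine add_le_add (add_le_add le_rfl ?_) h2
      simp only [Data.size]
      omega
  exact ((hl'.pair (hs.pair id)).trans main).fst

end Computes

/-! ### Decidable predicates and numbers -/

open Classical in
/-- The code of a truth value that the case distinction of programs expects. -/
noncomputable def truth (P : Prop) : Data := if P then .num 1 else .nil

/-- The code of a natural number. -/
def encNat (a : ℕ) : Data := .num (a : ℚ)

/-- The predicate `P` is decidable in polynomial time from the environment `e`. -/
def Decides {ι : Type} (e : ι → Data) (P : ι → Prop) : Prop := Computes e fun i => truth (P i)

variable {ι : Type} {e : ι → Data}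

theorem size_truth_le (P : Prop) : (truth P).size ≤ 3 := by
  unfold truth
  split_ifs <;> simp [Data.size]

theorem truth_eq_nil {P : Prop} : truth P = .nil ↔ ¬ P := by
  unfold truth
  split_ifs <;> simpa

theorem size_encNat_le (a : ℕ) : (encNat a).size ≤ a + 2 := size_num_natCast_le a

theorem Computes.ite {P : ι → Prop} [∀ i, Decidable (P i)] {g h : ι → Data} (hP : Decides e P)
    (hg : Computes e g) (hh : Computes e h) : Computes e fun i => if P i then g i else h i := by
  classical
  refine (hP.ifNil hh hg).congr fun i => ?_
  by_cases hi : P i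
  · rw [if_neg (by rwa [truth_eq_nil, not_not]), if_pos hi]
  · rw [if_pos (by rwa [truth_eq_nil]), if_neg hi]

namespace Decides

variable {P Q : ι → Prop}

theorem congr (hP : Decides e P) (h : ∀ i, P i ↔ Q i) : Decides e Q := by
  rwa [← funext fun i => propext (h i)]

theorem const (p : Prop) : Decides e fun _ => p := Computes.const _

theorem and (hP : Decides e P) (hQ : Decides e Q) : Decides e fun i => P i ∧ Q i := by
  classical
  refine (Computes.ite hP hQ (.const .nil)).congr fun i => ?_
  by_cases h : P i <;> simp [h, truth]

theorem not (hP : Decides e P) : Decides e fun i => ¬ P i := by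
  classical
  refine (Computes.ite hP (.const .nil) (.const (.num 1))).congr fun i => ?_
  by_cases h : P i <;> simp [h, truth]

theorem or (hP : Decides e P) (hQ : Decides e Q) : Decides e fun i => P i ∨ Q i :=
  (hP.not.and hQ.not).not.congr fun i => by tauto

theorem imp (hP : Decides e P) (hQ : Decides e Q) : Decides e fun i => P i → Q i :=
  (hP.and hQ.not).not.congr fun i => by tauto

theorem iff (hP : Decides e P) (hQ : Decides e Q) : Decides e fun i => (P i ↔ Q i) :=
  ((hP.imp hQ).and (hQ.imp hP)).congr fun i => by tauto

theorem val_le {f g : ι → Data} (hf : Computes e f) (hg : Computes e g) :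
    Decides e fun i => (f i).val ≤ (g i).val :=
  (hf.le hg).congr fun i => by simp [truth]

theorem num_le {a b : ι → ℚ} (ha : Computes e fun i => .num (a i))
    (hb : Computes e fun i => .num (b i)) : Decides e fun i => a i ≤ b i := val_le ha hb

theorem num_eq {a b : ι → ℚ} (ha : Computes e fun i => .num (a i))
    (hb : Computes e fun i => .num (b i)) : Decides e fun i => a i = b i :=
  ((num_le ha hb).and (num_le hb ha)).congr fun i => by rw [le_antisymm_iff]

theorem nat_le {a b : ι → ℕ} (ha : Computes e fun i => encNat (a i))
    (hb : Computes e fun i => encNat (b i)) : Decides e fun i => a i ≤ b i :=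
  (num_le ha hb).congr fun _ => Nat.cast_le

theorem nat_eq {a b : ι → ℕ} (ha : Computes e fun i => encNat (a i))
    (hb : Computes e fun i => encNat (b i)) : Decides e fun i => a i = b i :=
  (num_eq ha hb).congr fun _ => Nat.cast_inj

theorem ofProp (hP : Decides e P) : Computes e fun i => .ofProp (P i) := by
  classical
  refine (Computes.ite hP (.const (.num 1)) (.const (.num 0))).congr fun i => ?_
  unfold Data.ofProp
  congr

/-- Truth values in instances are coded by `1` and `0`, unlike those of programs. -/
theorem of_ofProp (hP : Computes e fun i => .ofProp (P i)) : Decides e P := by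
  refine (val_le (.const (.num 1)) hP).congr fun i => ?_
  unfold Data.ofProp
  split_ifs with h <;> simp [Data.val, h]

end Decides

namespace Computes

theorem encNat_add {a b : ι → ℕ} (ha : Computes e fun i => encNat (a i))
    (hb : Computes e fun i => encNat (b i)) : Computes e fun i => encNat (a i + b i) :=
  (ha.add hb).congr fun i => by simp [encNat, Data.val]

theorem encNat_sub {a b : ι → ℕ} (ha : Computes e fun i => encNat (a i))
    (hb : Computes e fun i => encNat (b i)) : Computes e fun i => encNat (a i - b i) := by
  classical
  have h : Computes e fun i => .num ((a i : ℚ) - b i) :=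
    (ha.add ((const (.num (-1))).mul hb)).congr fun i => by
      simp [encNat, Data.val, sub_eq_add_neg]
  refine (ite (Decides.nat_le hb ha) h (const (encNat 0))).congr fun i => ?_
  split_ifs with hi
  · simp [encNat, Nat.cast_sub hi]
  · rw [Nat.sub_eq_zero_of_le (le_of_not_ge hi)]

/-! ### Operations on lists -/

variable {α β : Type} {encA : α → Data} {encB : β → Data}

theorem encList_cons {a : ι → α} {l : ι → List α} (ha : Computes e fun i => encA (a i))
    (hl : Computes e fun i => encList encA (l i)) :
    Computes e fun i => encList encA (a i :: l i) := ha.pair hl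

theorem reverse_encList {l : ι → List α} (hl : Computes e fun i => encList encA (l i)) :
    Computes e fun i => encList encA (l i).reverse :=
  (reverse hl).congr fun i => by rw [encList, List.map_reverse]

/-- A function computable on the entries of a list has values of polynomially bounded size. -/
theorem exists_bound {l : ι → List α} {f : ι → α → Data}
    (hl : Computes e fun i => encList encA (l i))
    (hf : ∀ {κ : Type} {e' : κ → Data} (φ : κ → ι) (a : κ → α), (∀ x, a x ∈ l (φ x)) →
      Computes e' (fun x => e (φ x)) → Computes e' (fun x => encA (a x)) →
      Computes e' fun x => f (φ x) (a x)) :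
    ∃ B : ι → ℕ, PolyBdd e B ∧ ∀ i, ∀ a ∈ l i, (f i a).size ≤ B i := by
  let K := {x : ι × α // x.2 ∈ l x.1}
  have h0 : Computes (fun x : K => Data.cons (encA x.1.2) (e x.1.1)) _ := id
  obtain ⟨T, hT⟩ := (hf (fun x : K => x.1.1) (fun x => x.1.2) (fun x => x.2) h0.snd
    h0.fst).polyBdd_size
  refine ⟨_, (((PolyBdd.const 1).add hl.polyBdd_size).add .size).eval T, fun i a ha => ?_⟩
  refine (hT ⟨(i, a), ha⟩).trans (eval_le_eval T ?_)
  simp only [Data.size]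
  have := size_le_size_encList (enc := encA) ha
  omega

theorem map {l : ι → List α} {f : ι → α → β} (hl : Computes e fun i => encList encA (l i))
    (hf : ∀ {κ : Type} {e' : κ → Data} (φ : κ → ι) (a : κ → α), (∀ x, a x ∈ l (φ x)) →
      Computes e' (fun x => e (φ x)) → Computes e' (fun x => encA (a x)) →
      Computes e' fun x => encB (f (φ x) (a x))) :
    Computes e fun i => encList encB ((l i).map (f i)) := by
  obtain ⟨B, hB, hBs⟩ := exists_bound (f := fun i a => encB (f i a)) hl hf
  have h := foldr (encB := encList encB) (s := fun _ => []) (f := fun i a b => f i a :: b) hl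
    (const _) (fun φ a t b ht _ he ha hb =>
      encList_cons (hf φ a (fun x => (ht x).mem List.mem_cons_self) he ha) hb)
    ⟨_, (PolyBdd.const 1).add (hl.polyBdd_size.mul ((PolyBdd.const 1).add hB)), fun i t ht => by
      rw [List.foldr_cons_eq_append, List.append_nil]
      refine (Data.size_ofList_le_mul _ (B i) ?_).trans ?_
      · intro d hd
        simp only [List.map_map, List.mem_map, Function.comp] at hd
        obtain ⟨a, ha, rfl⟩ := hd
        exact hBs i a (ht.mem ha)
      · have h1 := ht.length_le.trans (length_le_size_encList encA (l i))
        simp only [List.length_map]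
        gcongr⟩
  exact h.congr fun i => by rw [List.foldr_cons_eq_append, List.append_nil]

theorem filter {l : ι → List α} {P : ι → α → Prop} [∀ i, DecidablePred (P i)]
    (hl : Computes e fun i => encList encA (l i))
    (hP : ∀ {κ : Type} {e' : κ → Data} (φ : κ → ι) (a : κ → α), (∀ x, a x ∈ l (φ x)) →
      Computes e' (fun x => e (φ x)) → Computes e' (fun x => encA (a x)) →
      Decides e' fun x => P (φ x) (a x)) :
    Computes e fun i => encList encA ((l i).filter fun a => P i a) := by
  have hfold (i : ι) (t : List α) : t.foldr (fun a b => if P i a then a :: b else b) [] =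
      t.filter fun a => P i a := by
    induction t with
    | nil => rfl
    | cons a t ih => by_cases h : P i a <;> simp [h, ih]
  have h := foldr (encB := encList encA) (s := fun _ => [])
    (f := fun i a b => if P i a then a :: b else b) hl
    (const _) (fun φ a t b ht _ he ha hb =>
      (ite (hP φ a (fun x => (ht x).mem List.mem_cons_self) he ha) (encList_cons ha hb) hb).congr
        fun x => by split_ifs <;> rfl)
    ⟨_, hl.polyBdd_size, fun i t ht => by
      rw [hfold]
      exact size_encList_le_of_sublist (List.filter_sublist.trans ht.sublist)⟩
  exact h.congr fun i => by rw [hfold]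

theorem append {l l' : ι → List α} (hl : Computes e fun i => encList encA (l i))
    (hl' : Computes e fun i => encList encA (l' i)) :
    Computes e fun i => encList encA (l i ++ l' i) := by
  have h := foldr (encB := encList encA) (f := fun _ a b => a :: b) hl hl'
    (fun φ a t b ht _ he ha hb => encList_cons ha hb)
    ⟨_, hl.polyBdd_size.add hl'.polyBdd_size, fun i t ht => by
      rw [List.foldr_cons_eq_append, List.map_id']
      exact (size_encList_append _ _ _).trans
        (Nat.add_le_add_right (size_encList_le_of_sublist ht.sublist) _)⟩
  exact h.congr fun i => by rw [List.foldr_cons_eq_append, List.map_id']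

theorem flatten {l : ι → List (List α)} (hl : Computes e fun i => encList (encList encA) (l i)) :
    Computes e fun i => encList encA (l i).flatten := by
  have hfold (t : List (List α)) : t.foldr (fun a b => a ++ b) [] = t.flatten := by
    induction t with
    | nil => rfl
    | cons a t ih => simp [ih]
  have hsize (t : List (List α)) :
      (encList encA t.flatten).size ≤ (encList (encList encA) t).size := by
    induction t with
    | nil => exact le_rfl
    | cons a t ih =>
      have := size_encList_append encA a t.flatten
      simp only [List.flatten_cons, Thin.encList_cons, Data.size]
      omega
  have h := foldr (encB := encList encA) (s := fun _ => []) (f := fun _ a b => a ++ b) hl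
    (const _) (fun φ a t b ht _ he ha hb => append ha hb)
    ⟨_, hl.polyBdd_size, fun i t ht => by
      rw [hfold]
      exact (hsize t).trans (size_encList_le_of_sublist ht.sublist)⟩
  exact h.congr fun i => by rw [hfold]

theorem forall_mem {l : ι → List α} {P : ι → α → Prop}
    (hl : Computes e fun i => encList encA (l i))
    (hP : ∀ {κ : Type} {e' : κ → Data} (φ : κ → ι) (a : κ → α), (∀ x, a x ∈ l (φ x)) →
      Computes e' (fun x => e (φ x)) → Computes e' (fun x => encA (a x)) →
      Decides e' fun x => P (φ x) (a x)) :
    Decides e fun i => ∀ a ∈ l i, P i a := by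
  have h := foldr (encB := truth) (s := fun _ => True) (f := fun i a b => P i a ∧ b) hl
    (const _) (fun φ a t b ht _ he ha hb =>
      (hP φ a (fun x => (ht x).mem List.mem_cons_self) he ha).and hb)
    ⟨_, .const 3, fun i t ht => size_truth_le _⟩
  refine Decides.congr h fun i => ?_
  induction l i with
  | nil => simp
  | cons a t ih => simp [ih]

theorem exists_mem {l : ι → List α} {P : ι → α → Prop}
    (hl : Computes e fun i => encList encA (l i))
    (hP : ∀ {κ : Type} {e' : κ → Data} (φ : κ → ι) (a : κ → α), (∀ x, a x ∈ l (φ x)) →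
      Computes e' (fun x => e (φ x)) → Computes e' (fun x => encA (a x)) →
      Decides e' fun x => P (φ x) (a x)) :
    Decides e fun i => ∃ a ∈ l i, P i a :=
  (forall_mem (P := fun i a => ¬ P i a) hl fun φ a ha he hae =>
    (hP φ a ha he hae).not).not.congr fun i => by
    push Not
    exact Iff.rfl

theorem length {l : ι → List α} (hl : Computes e fun i => encList encA (l i)) :
    Computes e fun i => encNat (l i).length := by
  have hfold (t : List α) : t.foldr (fun _ b => b + 1) 0 = t.length := by
    induction t with
    | nil => rfl
    | cons a t ih => simp [ih]
  have h := foldr (encB := encNat) (s := fun _ => 0) (f := fun _ _ b => b + 1) hl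
    (const _) (fun φ a t b ht _ he ha hb => encNat_add hb (const (encNat 1)))
    ⟨_, hl.polyBdd_size.add (.const 2), fun i t ht => by
      rw [hfold]
      exact (size_encNat_le _).trans (Nat.add_le_add_right
        (ht.length_le.trans (length_le_size_encList encA _)) _)⟩
  exact h.congr fun i => by rw [hfold]

/-- The positions in a given list. Loops need a list to run over, so this is what makes a range
available for quantifiers and sums. -/
theorem range_length {l : ι → List α} (hl : Computes e fun i => encList encA (l i)) :
    Computes e fun i => encList encNat (List.range (l i).length) := by
  have hfold (t : List α) : t.foldr (fun _ b => b.length :: b) [] =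
      (List.range t.length).reverse := by
    induction t with
    | nil => rfl
    | cons a t ih => simp [ih, List.range_succ]
  have h := foldr (encB := encList encNat) (s := fun _ => []) (f := fun _ _ b => b.length :: b) hl
    (const _) (fun φ a t b ht _ he ha hb => encList_cons (length hb) hb)
    ⟨_, (PolyBdd.const 1).add (hl.polyBdd_size.mul
      ((PolyBdd.const 1).add (hl.polyBdd_size.add (.const 2)))), fun i t ht => by
      have h1 := ht.length_le.trans (length_le_size_encList encA _)
      rw [hfold]
      refine (Data.size_ofList_le_mul _ ((encList encA (l i)).size + 2) ?_).trans ?_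
      · intro d hd
        simp only [List.mem_map, List.mem_reverse, List.mem_range] at hd
        obtain ⟨a, ha, rfl⟩ := hd
        have := size_encNat_le a
        omega
      · simp only [List.length_map, List.length_reverse, List.length_range]
        gcongr⟩
  exact (reverse_encList h).congr fun i => by rw [hfold, List.reverse_reverse]

/-- Random access to the entries of a list. -/
theorem getD {l : ι → List Data} {u : ι → ℕ} (hl : Computes e fun i => .ofList (l i))
    (hu : Computes e fun i => encNat (u i)) : Computes e fun i => (l i).getD (u i) .nil := by
  classical
  have hl' : Computes e fun i => encList (fun d => d) (l i) := hl.congr fun i => by simp [encList]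
  have hlen := length hl'
  -- The first component counts the entries from the end, so that an entry is reached at position
  -- `u i` when the count becomes the length minus `u i`.
  let f : ι → Data → ℕ × Data → ℕ × Data := fun i a b =>
    (b.1 + 1, if b.1 + 1 + u i = (l i).length then a else b.2)
  have hfold (i : ι) (t : List Data) : t.foldr (f i) (0, .nil) = (t.length,
      if (l i).length ≤ u i + t.length then t.getD (u i + t.length - (l i).length) .nil
      else .nil) := by
    induction t with
    | nil => simp
    | cons a t ih =>
      rw [List.foldr_cons, ih]
      simp only [f, List.length_cons, Prod.mk.injEq, true_and]
      rcases lt_trichotomy (t.length + 1 + u i) (l i).length with h | h | h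
      · rw [if_neg h.ne, if_neg (by omega), if_neg (by omega)]
      · rw [if_pos h, if_pos (by omega), show u i + (t.length + 1) - (l i).length = 0 by omega]
        rfl
      · rw [if_neg h.ne', if_pos (by omega), if_pos (by omega),
          show u i + (t.length + 1) - (l i).length = (u i + t.length - (l i).length) + 1 by omega]
        rfl
  have hmem (t : List Data) (m : ℕ) : (t.getD m .nil).size ≤ (Data.ofList t).size := by
    by_cases hm : m < t.length
    · rw [List.getD_eq_getElem _ _ hm]
      exact Data.size_le_size_ofList (List.getElem_mem hm)
    · rw [List.getD_eq_default _ _ (by omega)]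
      exact Data.size_pos _
  have h := foldr (encB := fun b : ℕ × Data => .cons (encNat b.1) b.2) (s := fun _ => (0, .nil))
    (f := f) hl' (const _) (fun φ a t b ht _ he ha hb =>
      have h1 := encNat_add hb.fst (const (encNat 1))
      pair h1 (ite (Decides.nat_eq (encNat_add h1 (hu.lift he)) (hlen.lift he)) ha hb.snd))
    ⟨_, (PolyBdd.const 1).add ((hl.polyBdd_size.add (.const 2)).add hl.polyBdd_size),
      fun i t ht => by
        have h1 := (hmem t (u i + t.length - (l i).length)).trans
          (Data.size_ofList_le_of_sublist ht.sublist)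
        have h2 := ht.length_le.trans (Data.length_le_size_ofList (l i))
        have h3 := size_encNat_le t.length
        have h4 := Data.size_pos (Data.ofList (l i))
        rw [hfold]
        simp only [Data.size]
        have h5 : Data.nil.size = 1 := rfl
        split_ifs <;> omega⟩
  exact h.snd.congr fun i => by
    rw [hfold]
    simp [Data.snd]

/-- The default of `getD` is coded by `nil`, whose value as a number is `0`. -/
theorem encNat_getD {l : ι → List ℕ} {u : ι → ℕ} (hl : Computes e fun i => encList encNat (l i))
    (hu : Computes e fun i => encNat (u i)) : Computes e fun i => encNat ((l i).getD (u i) 0) := by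
  refine ((getD hl hu).add (const (.num 0))).congr fun i => ?_
  by_cases h : u i < (l i).length
  · simp [h, encNat, Data.val]
  · simp [not_lt.1 h, encNat, Data.val]

/-! ### Operations on finite families -/

variable {n : ι → ℕ}

theorem getD_ofFn {f : ∀ i, Fin (n i) → Data} {u : ∀ i, Fin (n i)}
    (hf : Computes e fun i => .ofFn (f i)) (hu : Computes e fun i => encNat (u i)) :
    Computes e fun i => f i (u i) :=
  (getD hf hu).congr fun i => by simp

theorem range_of_ofFn {f : ∀ i, Fin (n i) → Data} (hf : Computes e fun i => .ofFn (f i)) :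
    Computes e fun i => encList encNat (List.range (n i)) :=
  (range_length (encA := fun d => d) (l := fun i => List.ofFn (f i))
    (hf.congr fun i => by rw [encList, List.map_id', Data.ofFn])).congr fun i => by simp

theorem ofFn {f : ∀ i, Fin (n i) → Data}
    (hn : Computes e fun i => encList encNat (List.range (n i)))
    (hf : ∀ {κ : Type} {e' : κ → Data} (φ : κ → ι) (u : ∀ x, Fin (n (φ x))),
      Computes e' (fun x => e (φ x)) → Computes e' (fun x => encNat (u x)) →
      Computes e' fun x => f (φ x) (u x)) :
    Computes e fun i => .ofFn (f i) := by
  have h := map (encB := fun d => d)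
    (f := fun i a => if h : a < n i then f i ⟨a, h⟩ else .nil) hn (fun φ a ha he hae =>
      (hf φ (fun x => ⟨a x, List.mem_range.1 (ha x)⟩) he hae).congr fun x => by
        rw [dif_pos (List.mem_range.1 (ha x))])
  refine h.congr fun i => ?_
  simp only [encList, Data.ofFn, List.map_map]
  congr 1
  refine List.ext_getElem (by simp) fun m h1 h2 => ?_
  simp only [List.length_map, List.length_range] at h1
  simp [h1]

theorem forall_fin {P : ∀ i, Fin (n i) → Prop}
    (hn : Computes e fun i => encList encNat (List.range (n i)))
    (hP : ∀ {κ : Type} {e' : κ → Data} (φ : κ → ι) (u : ∀ x, Fin (n (φ x))),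
      Computes e' (fun x => e (φ x)) → Computes e' (fun x => encNat (u x)) →
      Decides e' fun x => P (φ x) (u x)) :
    Decides e fun i => ∀ u, P i u := by
  have h := forall_mem (P := fun i a => ∀ h : a < n i, P i ⟨a, h⟩) hn (fun φ a ha he hae =>
      (hP φ (fun x => ⟨a x, List.mem_range.1 (ha x)⟩) he hae).congr fun x =>
        ⟨fun h _ => h, fun h => h _⟩)
  exact h.congr fun i => ⟨fun h u => h u (List.mem_range.2 u.2) u.2, fun h a _ ha => h ⟨a, ha⟩⟩

theorem exists_fin {P : ∀ i, Fin (n i) → Prop}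
    (hn : Computes e fun i => encList encNat (List.range (n i)))
    (hP : ∀ {κ : Type} {e' : κ → Data} (φ : κ → ι) (u : ∀ x, Fin (n (φ x))),
      Computes e' (fun x => e (φ x)) → Computes e' (fun x => encNat (u x)) →
      Decides e' fun x => P (φ x) (u x)) :
    Decides e fun i => ∃ u, P i u :=
  (forall_fin (P := fun i u => ¬ P i u) hn fun φ u he hu =>
    (hP φ u he hu).not).not.congr fun i => by
    push Not
    exact Iff.rfl

theorem range_const (m : ℕ) : Computes e fun _ => encList encNat (List.range m) := const _

/-- Sums of rational numbers: the partial sums have polynomial size since `ratLength` is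
subadditive. -/
theorem sum {f : ∀ i, Fin (n i) → ℚ}
    (hn : Computes e fun i => encList encNat (List.range (n i)))
    (hf : ∀ {κ : Type} {e' : κ → Data} (φ : κ → ι) (u : ∀ x, Fin (n (φ x))),
      Computes e' (fun x => e (φ x)) → Computes e' (fun x => encNat (u x)) →
      Computes e' fun x => .num (f (φ x) (u x))) :
    Computes e fun i => .num (∑ u, f i u) := by
  let F : ι → ℕ → ℚ := fun i a => if h : a < n i then f i ⟨a, h⟩ else 0
  have hF : ∀ {κ : Type} {e' : κ → Data} (φ : κ → ι) (a : κ → ℕ),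
      (∀ x, a x ∈ List.range (n (φ x))) →
      Computes e' (fun x => e (φ x)) → Computes e' (fun x => encNat (a x)) →
      Computes e' fun x => .num (F (φ x) (a x)) := fun φ a ha he hae =>
    (hf φ (fun x => ⟨a x, List.mem_range.1 (ha x)⟩) he hae).congr fun x => by
      simp only [F]
      rw [dif_pos (List.mem_range.1 (ha x))]
  obtain ⟨B, hB, hBs⟩ := exists_bound (f := fun i a => .num (F i a)) hn hF
  have hsize (i : ι) (t : List ℕ) (ht : ∀ a ∈ t, a ∈ List.range (n i)) :
      ratLength (t.foldr (fun a b => F i a + b) 0) ≤ t.length * B i + 2 := by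
    induction t with
    | nil => simp [ratLength]
    | cons a t ih =>
      have h1 := ih fun b hb => ht b (List.mem_cons_of_mem _ hb)
      have h2 := (ratLength_le_size_num _).trans (hBs i a (ht a List.mem_cons_self))
      have h3 := ratLength_add_le (F i a) (t.foldr (fun a b => F i a + b) 0)
      simp only [List.foldr_cons, List.length_cons, Nat.succ_mul]
      omega
  have h := foldr (encB := Data.num) (s := fun _ => 0) (f := fun i a b => F i a + b) hn
    (const _) (fun φ a t b ht _ he ha hb =>
      (hF φ a (fun x => (ht x).mem List.mem_cons_self) he ha).add hb)
    ⟨_, (PolyBdd.const 2).mul ((hn.polyBdd_size.mul hB).add (.const 2)), fun i t ht => by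
      refine (size_num_le_ratLength _).trans (Nat.mul_le_mul_left _ ?_)
      refine (hsize i t fun a ha => ht.mem ha).trans ?_
      have h1 := ht.length_le.trans (length_le_size_encList encNat _)
      gcongr⟩
  refine h.congr fun i => ?_
  congr 1
  have hfold (t : List ℕ) : t.foldr (fun a b => F i a + b) 0 = (t.map (F i)).sum := by
    induction t with
    | nil => rfl
    | cons a t ih => simp [ih]
  have hrange : ((List.range (n i)).map (F i)).sum = ∑ a ∈ Finset.range (n i), F i a := by
    simp [Finset.sum, Finset.range, Multiset.range]
  rw [hfold, hrange, Finset.sum_range]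
  exact Finset.sum_congr rfl fun u _ => by simp [F]

end Computes

/-! ### Best representatives of the classes of an equivalence relation -/

section Best

variable {α X : Type}

open Classical in
/-- Insert `a` into a list that has at most one entry for each value of `s`, keeping the entry of
larger value `v` in case of a collision. -/
noncomputable def insertBest (s : α → X) (v : α → ℚ) (a : α) (l : List α) : List α :=
  if ∃ b ∈ l, s b = s a ∧ v a ≤ v b then l else a :: l.filter fun b => ¬ s b = s a

/-- For each value of `s` on the list, one entry of largest value `v` among those on which `s`
takes that value. -/
noncomputable def best (s : α → X) (v : α → ℚ) (l : List α) : List α :=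
  l.foldr (insertBest s v) []

variable (s : α → X) (v : α → ℚ)

theorem mem_of_mem_best {l : List α} {b : α} (h : b ∈ best s v l) : b ∈ l := by
  induction l with
  | nil => simp [best] at h
  | cons a l ih =>
    rw [best, List.foldr_cons, ← best, insertBest] at h
    split_ifs at h
    · exact List.mem_cons_of_mem _ (ih h)
    · rcases List.mem_cons.1 h with rfl | h
      · exact List.mem_cons_self
      · exact List.mem_cons_of_mem _ (ih (List.mem_of_mem_filter h))

theorem nodup_map_best (l : List α) : ((best s v l).map s).Nodup := by
  induction l with
  | nil => simp [best]
  | cons a l ih =>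
    rw [best, List.foldr_cons, ← best, insertBest]
    split_ifs
    · exact ih
    · rw [List.map_cons, List.nodup_cons]
      refine ⟨?_, ih.sublist (List.filter_sublist.map s)⟩
      simp only [List.mem_map, List.mem_filter]
      rintro ⟨b, ⟨_, hb⟩, h⟩
      simp [h] at hb

theorem exists_mem_best {l : List α} {a : α} (h : a ∈ l) :
    ∃ b ∈ best s v l, s b = s a ∧ v a ≤ v b := by
  induction l with
  | nil => simp at h
  | cons c l ih =>
    rw [best, List.foldr_cons, ← best, insertBest]
    split_ifs with hc
    · rcases List.mem_cons.1 h with rfl | h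
      · exact hc
      · exact ih h
    · rcases List.mem_cons.1 h with rfl | h
      · exact ⟨a, List.mem_cons_self, rfl, le_rfl⟩
      · obtain ⟨b, hb, hs, hv⟩ := ih h
        by_cases hbc : s b = s c
        · refine ⟨c, List.mem_cons_self, hbc ▸ hs, hv.trans ?_⟩
          by_contra hlt
          exact hc ⟨b, hb, hbc, (not_le.1 hlt).le⟩
        · exact ⟨b, List.mem_cons_of_mem _ (List.mem_filter.2 ⟨hb, by simpa using hbc⟩), hs, hv⟩

theorem size_encList_best_le (enc : α → Data) (l : List α) :
    (encList enc (best s v l)).size ≤ (encList enc l).size := by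
  classical
  induction l with
  | nil => exact le_rfl
  | cons a l ih =>
    rw [best, List.foldr_cons, ← best, insertBest]
    split_ifs
    · simp only [encList_cons, Data.size]
      omega
    · have := size_encList_le_of_sublist (enc := enc)
        (List.filter_sublist (l := best s v l) (p := fun b => decide (¬ s b = s a)))
      simp only [encList_cons, Data.size]
      omega

end Best

variable {ι : Type} {e : ι → Data}

theorem Computes.best {α : Type} {X : ι → Type} {enc : α → Data} {l : ι → List α}
    {s : ∀ i, α → X i} {v : ι → α → ℚ} (hl : Computes e fun i => encList enc (l i))
    (hs : ∀ {κ : Type} {e' : κ → Data} (φ : κ → ι) (a b : κ → α),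
      Computes e' (fun x => e (φ x)) → Computes e' (fun x => enc (a x)) →
      Computes e' (fun x => enc (b x)) → Decides e' fun x => s (φ x) (a x) = s (φ x) (b x))
    (hv : ∀ {κ : Type} {e' : κ → Data} (φ : κ → ι) (a : κ → α),
      Computes e' (fun x => e (φ x)) → Computes e' (fun x => enc (a x)) →
      Computes e' fun x => .num (v (φ x) (a x))) :
    Computes e fun i => encList enc (best (s i) (v i) (l i)) := by
  classical
  refine foldr (encB := encList enc) (s := fun _ => []) (f := fun i => insertBest (s i) (v i)) hl
    (const _) (fun φ a t b ht _ he ha hb => ?_)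
    ⟨_, hl.polyBdd_size, fun i t ht => (size_encList_best_le _ _ _ _).trans
      (size_encList_le_of_sublist ht.sublist)⟩
  refine (ite (P := fun x => ∃ c ∈ b x, s (φ x) c = s (φ x) (a x) ∧ v (φ x) (a x) ≤ v (φ x) c)
    (exists_mem hb fun ψ c _ he' hc => ?_) hb
    (encList_cons ha (filter (P := fun x c => ¬ s (φ x) c = s (φ x) (a x)) hb
      fun ψ c _ he' hc => ?_))).congr fun x => ?_
  · exact (hs _ c _ (he.lift he') hc (ha.lift he')).and
      (Decides.num_le (hv _ _ (he.lift he') (ha.lift he')) (hv _ c (he.lift he') hc))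
  · exact (hs _ c _ (he.lift he') hc (ha.lift he')).not
  · unfold insertBest
    split_ifs
    · rfl
    · congr

/-! ### Dynamic programming -/

/-- A maximization problem over the words of length `n` in the letters `0, …, N - 1` that is solved
from the back: `valid u w` says that the word `w` is an admissible choice of the letters at the
positions `u, u + 1, …`, and `val u w` is what it contributes to the objective. The signature
`sig u w` is all that has to be remembered of `w` when the letters before position `u` are chosen;
the last condition on complete words, `final`, depends on the signature only. -/
structure Stages (n : ℕ) where
  X : Type
  valid : ℕ → List ℕ → Prop
  sig : ℕ → List ℕ → X
  val : ℕ → List ℕ → ℚ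
  cost : ℕ → ℕ → ℚ
  final : List ℕ → Prop
  valid_nil : valid n []
  valid_tail : ∀ {u a w}, u < n → valid u (a :: w) → valid (u + 1) w
  valid_congr : ∀ {u a w w'}, u < n → sig (u + 1) w = sig (u + 1) w' → valid (u + 1) w' →
    valid u (a :: w) → valid u (a :: w')
  sig_congr : ∀ {u a w w'}, u < n → sig (u + 1) w = sig (u + 1) w' →
    sig u (a :: w) = sig u (a :: w')
  val_cons : ∀ {u a w}, u < n → val u (a :: w) = cost u a + val (u + 1) w
  final_congr : ∀ {w w'}, sig 0 w = sig 0 w' → final w → final w'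

namespace Stages

variable {n : ℕ} (D : Stages n) (N : ℕ)

/-- All words that arise by putting a letter in front of a word of the list. -/
def extensions (T : List (List ℕ)) : List (List ℕ) :=
  (T.map fun w => (List.range N).map fun a => a :: w).flatten

theorem mem_extensions {T : List (List ℕ)} {w : List ℕ} :
    w ∈ extensions N T ↔ ∃ a < N, ∃ w' ∈ T, w = a :: w' := by
  simp only [extensions, List.mem_flatten, List.mem_map]
  constructor
  · rintro ⟨_, ⟨w', hw', rfl⟩, h⟩
    obtain ⟨a, ha, rfl⟩ := List.mem_map.1 h
    exact ⟨a, List.mem_range.1 ha, w', hw', rfl⟩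
  · rintro ⟨a, ha, w', hw', rfl⟩
    exact ⟨_, ⟨w', hw', rfl⟩, List.mem_map.2 ⟨a, List.mem_range.2 ha, rfl⟩⟩

open Classical in
/-- The table of the dynamic program after the positions on the list (processed from its end): for
each signature of an admissible word, one admissible word of largest value. -/
noncomputable def table (t : List ℕ) : List (List ℕ) :=
  t.foldr (fun u T => best (D.sig u) (D.val u) ((extensions N T).filter fun w => D.valid u w)) [[]]

/-- The words over `0, …, N - 1` that are an admissible choice for all positions from `u` on. -/
def Admissible (u : ℕ) (w : List ℕ) : Prop :=
  w.length + u = n ∧ (∀ a ∈ w, a < N) ∧ D.valid u w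

theorem table_cons (u : ℕ) (t : List ℕ) [DecidablePred (D.valid u)] :
    D.table N (u :: t) =
      best (D.sig u) (D.val u) ((extensions N (D.table N t)).filter fun w => D.valid u w) := by
  rw [table, List.foldr_cons, ← table]
  congr!

theorem mem_table {t : List ℕ} {w : List ℕ} (h : w ∈ D.table N t) :
    w.length = t.length ∧ ∀ a ∈ w, a < N := by
  classical
  induction t generalizing w with
  | nil =>
    obtain rfl : w = [] := by simpa [table] using h
    simp
  | cons u t ih =>
    rw [table_cons] at h
    obtain ⟨a, ha, w', hw', rfl⟩ :=
      (mem_extensions N).1 (List.mem_of_mem_filter (mem_of_mem_best _ _ h))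
    obtain ⟨h1, h2⟩ := ih hw'
    exact ⟨by simp [h1], by simpa [ha] using h2⟩

/-- The table consists of admissible words, and each admissible word is matched by one in the table
of the same signature and at least the same value. -/
theorem table_spec (d u : ℕ) (hd : d + u = n) :
    (∀ w ∈ D.table N (List.range' u d), D.Admissible N u w) ∧
    ∀ w, D.Admissible N u w →
      ∃ w' ∈ D.table N (List.range' u d), D.sig u w' = D.sig u w ∧ D.val u w ≤ D.val u w' := by
  classical
  induction d generalizing u with
  | zero =>
    obtain rfl : u = n := by omega
    refine ⟨fun w hw => ?_, fun w hw => ?_⟩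
    · obtain rfl : w = [] := by simpa [table] using hw
      exact ⟨by simp, by simp, D.valid_nil⟩
    · obtain rfl : w = [] := List.length_eq_zero_iff.1 (by have := hw.1; omega)
      exact ⟨[], by simp [table], rfl, le_rfl⟩
  | succ d ih =>
    obtain ⟨ih1, ih2⟩ := ih (u + 1) (by omega)
    rw [List.range'_succ, table_cons]
    refine ⟨fun w hw => ?_, fun w hw => ?_⟩
    · have hw := mem_of_mem_best _ _ hw
      rw [List.mem_filter, mem_extensions] at hw
      obtain ⟨⟨a, ha, w', hw', rfl⟩, hv⟩ := hw
      obtain ⟨h1, h2, _⟩ := ih1 w' hw'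
      exact ⟨by simp; omega, by simpa [ha] using h2, by simpa using hv⟩
    · obtain ⟨h1, h2, h3⟩ := hw
      obtain ⟨a, w, rfl⟩ : ∃ a w', w = a :: w' := by
        cases w with
        | nil => simp at h1; omega
        | cons a w => exact ⟨a, w, rfl⟩
      have hu : u < n := by omega
      obtain ⟨w', hw', hs, hv⟩ := ih2 w ⟨by simp at h1; omega,
        fun b hb => h2 b (List.mem_cons_of_mem _ hb), D.valid_tail hu h3⟩
      have hmem : a :: w' ∈ (extensions N (D.table N (List.range' (u + 1) d))).filter
          fun w => D.valid u w := by
        rw [List.mem_filter, mem_extensions]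
        exact ⟨⟨a, h2 a List.mem_cons_self, w', hw', rfl⟩,
          by simpa using D.valid_congr hu hs.symm (ih1 w' hw').2.2 h3⟩
      obtain ⟨b, hb, hbs, hbv⟩ := exists_mem_best (D.sig u) (D.val u) hmem
      refine ⟨b, hb, hbs.trans (D.sig_congr hu hs), le_trans ?_ hbv⟩
      rw [D.val_cons hu, D.val_cons hu]
      gcongr

open Classical in
/-- An optimal word as a one-element list; empty if there is no word that meets all conditions. -/
noncomputable def solution : List (List ℕ) :=
  best (fun _ => ()) (D.val 0) ((D.table N (List.range n)).filter D.final)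

theorem solution_spec :
    (D.solution N = [] ∧ ∀ w, D.Admissible N 0 w → ¬ D.final w) ∨
    ∃ w, D.solution N = [w] ∧ D.Admissible N 0 w ∧ D.final w ∧
      ∀ w', D.Admissible N 0 w' → D.final w' → D.val 0 w' ≤ D.val 0 w := by
  classical
  obtain ⟨h1, h2⟩ := D.table_spec N n 0 rfl
  rw [← List.range_eq_range'] at h1 h2
  have h3 (w) (hw : D.Admissible N 0 w) (hf : D.final w) :
      ∃ b ∈ D.solution N, D.val 0 w ≤ D.val 0 b := by
    obtain ⟨w', hw', hs, hv⟩ := h2 w hw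
    obtain ⟨b, hb, _, hbv⟩ := exists_mem_best (fun _ => ()) (D.val 0)
      (l := (D.table N (List.range n)).filter D.final) (a := w')
      (List.mem_filter.2 ⟨hw', by simpa using D.final_congr hs.symm hf⟩)
    exact ⟨b, by rw [solution]; convert hb, hv.trans hbv⟩
  have hnd := nodup_map_best (fun _ => ()) (D.val 0) ((D.table N (List.range n)).filter D.final)
  have hmem (w) (hw : w ∈ D.solution N) : D.Admissible N 0 w ∧ D.final w := by
    have hw := List.mem_filter.1 (mem_of_mem_best _ _ hw)
    exact ⟨h1 w hw.1, by simpa using hw.2⟩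
  -- All words have the same image in `Unit`, so that at most one is kept.
  have hlen : (D.solution N).length ≤ 1 := by
    have := hnd.length_le_card
    simpa [solution] using this
  match hS : D.solution N with
  | [] =>
    refine Or.inl ⟨rfl, fun w hw hf => ?_⟩
    obtain ⟨b, hb, _⟩ := h3 w hw hf
    simp [hS] at hb
  | [w] =>
    refine Or.inr ⟨w, rfl, (hmem w (by simp [hS])).1, (hmem w (by simp [hS])).2, fun w' hw hf => ?_⟩
    obtain ⟨b, hb, hv⟩ := h3 w' hw hf
    obtain rfl : b = w := by simpa [hS] using hb
    exact hv
  | _ :: _ :: _ => simp [hS] at hlen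

end Stages

/-- The dynamic program runs in polynomial time if its ingredients do and if the number of
signatures at each stage is polynomially bounded. -/
theorem Computes.solution {n : ι → ℕ} (D : ∀ i, Stages (n i)) (N : ℕ)
    (hn : Computes e fun i => encList encNat (List.range (n i)))
    (hvalid : ∀ {κ : Type} {e' : κ → Data} (φ : κ → ι) (u : κ → ℕ) (w : κ → List ℕ),
      Computes e' (fun x => e (φ x)) → Computes e' (fun x => encNat (u x)) →
      Computes e' (fun x => encList encNat (w x)) →
      Decides e' fun x => (D (φ x)).valid (u x) (w x))
    (hsig : ∀ {κ : Type} {e' : κ → Data} (φ : κ → ι) (u : κ → ℕ) (w w' : κ → List ℕ),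
      Computes e' (fun x => e (φ x)) → Computes e' (fun x => encNat (u x)) →
      Computes e' (fun x => encList encNat (w x)) → Computes e' (fun x => encList encNat (w' x)) →
      Decides e' fun x => (D (φ x)).sig (u x) (w x) = (D (φ x)).sig (u x) (w' x))
    (hval : ∀ {κ : Type} {e' : κ → Data} (φ : κ → ι) (u : κ → ℕ) (w : κ → List ℕ),
      Computes e' (fun x => e (φ x)) → Computes e' (fun x => encNat (u x)) →
      Computes e' (fun x => encList encNat (w x)) →
      Computes e' fun x => .num ((D (φ x)).val (u x) (w x)))
    (hfinal : ∀ {κ : Type} {e' : κ → Data} (φ : κ → ι) (w : κ → List ℕ),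
      Computes e' (fun x => e (φ x)) → Computes e' (fun x => encList encNat (w x)) →
      Decides e' fun x => (D (φ x)).final (w x))
    (hcard : ∃ B : ι → ℕ, PolyBdd e B ∧ ∀ i, ∀ u < n i, ∀ l : List (List ℕ),
      (l.map ((D i).sig u)).Nodup → l.length ≤ B i) :
    Computes e fun i => encList (encList encNat) ((D i).solution N) := by
  classical
  obtain ⟨B, hB, hBl⟩ := hcard
  have htable : Computes e fun i =>
      encList (encList encNat) ((D i).table N (List.range (n i))) := by
    refine foldr (encB := encList (encList encNat)) (s := fun _ => [[]])
      (f := fun i u T => Thin.best ((D i).sig u) ((D i).val u)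
        ((Stages.extensions N T).filter fun w => (D i).valid u w)) hn (const _)
      (fun φ u t T _ _ he hu hT => ?_) ?_
    · have hext : Computes _ fun x => encList (encList encNat) (Stages.extensions N (T x)) :=
        flatten (map hT fun ψ w _ he' hw => map (range_const N) fun χ a _ he'' ha =>
          encList_cons ha (hw.lift he''))
      refine best (filter hext fun ψ w _ he' hw => hvalid _ _ w (he.lift he') (hu.lift he') hw)
        (fun ψ w w' he' hw hw' => hsig _ _ w w' (he.lift he') (hu.lift he') hw hw')
        (fun ψ w he' hw => hval _ _ w (he.lift he') (hu.lift he') hw)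
    -- At most `B i` words are kept (one if no position has been treated), each with at most `n i`
    -- letters below `N`.
    · refine ⟨fun i => 1 + (B i + 1) *
          (1 + (1 + (encList encNat (List.range (n i))).size * (1 + (N + 2)))),
        (PolyBdd.const 1).add ((hB.add (.const 1)).mul ((PolyBdd.const 1).add
          ((PolyBdd.const 1).add (hn.polyBdd_size.mul (.const _))))), fun i t ht => ?_⟩
      have hlen : ((D i).table N t).length ≤ B i + 1 := by
        cases t with
        | nil => simp [Stages.table]
        | cons u t =>
          rw [Stages.table_cons]
          exact (hBl i u (List.mem_range.1 (ht.mem List.mem_cons_self)) _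
            (nodup_map_best _ _ _)).trans (Nat.le_succ _)
      change (encList _ ((D i).table N t)).size ≤ _
      refine (Data.size_ofList_le_mul _
        (1 + (encList encNat (List.range (n i))).size * (1 + (N + 2))) fun d hd => ?_).trans ?_
      · obtain ⟨w, hw, rfl⟩ := List.mem_map.1 hd
        obtain ⟨h1, h2⟩ := (D i).mem_table N hw
        have h3 := ht.length_le.trans (length_le_size_encList encNat _)
        refine (Data.size_ofList_le_mul _ (N + 2) fun d hd => ?_).trans ?_
        · obtain ⟨a, ha, rfl⟩ := List.mem_map.1 hd
          have := h2 a ha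
          have := size_encNat_le a
          omega
        · rw [List.length_map, h1]
          exact Nat.add_le_add_left (Nat.mul_le_mul_right _ h3) _
      · rw [List.length_map]
        exact Nat.add_le_add_left (Nat.mul_le_mul_right _ hlen) _
  refine best (X := fun _ => Unit) (filter htable fun φ w _ he hw => hfinal φ w he hw)
    (fun _ _ _ _ _ _ => Decides.const True |>.congr fun _ => by simp)
    (fun φ w he hw => hval φ (fun _ => 0) w he (const _) hw)

/-! ### Families indexed by the subsets of a fixed finite set -/

/-- The subsets of `Fin r`, in the order used by `Data.ofFamily`. -/
def subsets (r : ℕ) : List (Finset (Fin r)) := (List.finRange r).sublists.map List.toFinset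

/-- The subset of `Fin r` with a given number (and the empty set for numbers out of range). -/
def subsetAt (r a : ℕ) : Finset (Fin r) := (subsets r).getD a ∅

/-- The number of entries of `subsets`. -/
def numSubsets (r : ℕ) : ℕ := (subsets r).length

theorem exists_subsetAt {r : ℕ} (A : Finset (Fin r)) : ∃ a < numSubsets r, subsetAt r a = A := by
  have h : A ∈ subsets r := by
    refine List.mem_map.2 ⟨(List.finRange r).filter (· ∈ A), ?_, ?_⟩
    · exact List.mem_sublists.2 List.filter_sublist
    · ext j
      simp
  obtain ⟨a, ha, rfl⟩ := List.mem_iff_getElem.1 h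
  exact ⟨a, ha, List.getD_eq_getElem _ _ ha⟩

theorem lt_numSubsets_of_mem {r a : ℕ} {j : Fin r} (h : j ∈ subsetAt r a) : a < numSubsets r := by
  by_contra ha
  rw [subsetAt, List.getD_eq_default _ _ (not_lt.1 ha)] at h
  simp at h

variable {ι : Type} {e : ι → Data}

theorem Decides.eq_nil {g : ι → Data} (hg : Computes e g) : Decides e fun i => g i = .nil :=
  (hg.ifNil (.const (.num 1)) (.const .nil)).congr fun i => by
    unfold truth
    congr

/-- A relation between natural numbers that holds for finitely many pairs only is decidable by a
look-up. -/
theorem Decides.of_bounded {P : ℕ → ℕ → Prop} {m m' : ℕ} (hP : ∀ a b, P a b → a < m ∧ b < m')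
    {a b : ι → ℕ} (ha : Computes e fun i => encNat (a i)) (hb : Computes e fun i => encNat (b i)) :
    Decides e fun i => P (a i) (b i) := by
  classical
  let l := ((Finset.range m ×ˢ Finset.range m').filter fun c => P c.1 c.2).toList
  have h := Computes.exists_mem (encA := fun c : ℕ × ℕ => .cons (encNat c.1) (encNat c.2))
    (l := fun _ : ι => l) (P := fun i c => a i = c.1 ∧ b i = c.2) (.const _)
    fun φ c _ he hc => (nat_eq (ha.lift he) hc.fst).and (nat_eq (hb.lift he) hc.snd)
  refine h.congr fun i => ?_
  constructor
  · rintro ⟨c, hc, h1, h2⟩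
    rw [h1, h2]
    simp only [l, Finset.mem_toList, Finset.mem_filter] at hc
    exact hc.2
  · intro h
    refine ⟨(a i, b i), ?_, rfl, rfl⟩
    simpa [l, h] using hP _ _ h

theorem Decides.mem_subsetAt {r : ℕ} {j : ι → Fin r} {a : ι → ℕ}
    (hj : Computes e fun i => encNat (j i)) (ha : Computes e fun i => encNat (a i)) :
    Decides e fun i => j i ∈ subsetAt r (a i) :=
  (of_bounded (P := fun a j => ∃ h : j < r, ⟨j, h⟩ ∈ subsetAt r a) (m := numSubsets r) (m' := r)
    (fun _ _ ⟨h, h'⟩ => ⟨lt_numSubsets_of_mem h', h⟩) ha hj).congr fun i => by simp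

theorem Decides.subsetAt_subset {r : ℕ} {a b : ι → ℕ} (ha : Computes e fun i => encNat (a i))
    (hb : Computes e fun i => encNat (b i)) :
    Decides e fun i => subsetAt r (a i) ⊆ subsetAt r (b i) :=
  Computes.forall_fin (n := fun _ => r) (Computes.range_const r) fun _ _ he hj =>
    (mem_subsetAt hj (ha.lift he)).imp (mem_subsetAt hj (hb.lift he))

theorem Decides.exists_subset {r : ℕ} {P : ι → Finset (Fin r) → Prop}
    (hP : ∀ {κ : Type} {e' : κ → Data} (φ : κ → ι) (a : κ → Fin (numSubsets r)),
      Computes e' (fun x => e (φ x)) → Computes e' (fun x => encNat (a x)) →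
      Decides e' fun x => P (φ x) (subsetAt r (a x))) :
    Decides e fun i => ∃ J, P i J :=
  (Computes.exists_fin (n := fun _ => numSubsets r) (P := fun i a => P i (subsetAt r a))
    (Computes.range_const _) hP).congr fun i =>
    ⟨fun ⟨_, h⟩ => ⟨_, h⟩, fun ⟨J, h⟩ => by
      obtain ⟨a, ha, rfl⟩ := exists_subsetAt J
      exact ⟨⟨a, ha⟩, h⟩⟩

theorem Decides.forall_subset {r : ℕ} {P : ι → Finset (Fin r) → Prop}
    (hP : ∀ {κ : Type} {e' : κ → Data} (φ : κ → ι) (a : κ → Fin (numSubsets r)),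
      Computes e' (fun x => e (φ x)) → Computes e' (fun x => encNat (a x)) →
      Decides e' fun x => P (φ x) (subsetAt r (a x))) :
    Decides e fun i => ∀ J, P i J :=
  (Computes.forall_fin (n := fun _ => numSubsets r) (P := fun i a => P i (subsetAt r a))
    (Computes.range_const _) hP).congr fun i =>
    ⟨fun h J => by
      obtain ⟨a, ha, rfl⟩ := exists_subsetAt J
      exact h ⟨a, ha⟩, fun h _ => h _⟩

theorem Computes.getD_ofFamily {r : ℕ} {f : ι → Finset (Fin r) → Data} {a : ι → Fin (numSubsets r)}
    (hf : Computes e fun i => .ofFamily (f i)) (ha : Computes e fun i => encNat (a i)) :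
    Computes e fun i => f i (subsetAt r (a i)) :=
  (getD (l := fun i => (subsets r).map (f i)) hf ha).congr fun i => by
    have h : (a i : ℕ) < (subsets r).length := (a i).2
    rw [subsetAt, List.getD_eq_getElem _ _ h,
      List.getD_eq_getElem _ _ (by rwa [List.length_map]), List.getElem_map]

theorem Computes.ofFamily {r : ℕ} {f : ι → Finset (Fin r) → Data}
    (hf : ∀ {κ : Type} {e' : κ → Data} (φ : κ → ι) (a : κ → Fin (numSubsets r)),
      Computes e' (fun x => e (φ x)) → Computes e' (fun x => encNat (a x)) →
      Computes e' fun x => f (φ x) (subsetAt r (a x))) :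
    Computes e fun i => .ofFamily (f i) :=
  (ofFn (n := fun _ => numSubsets r) (f := fun i a => f i (subsetAt r a)) (range_const _)
    hf).congr fun i => by
      rw [Data.ofFn, Data.ofFamily, ← subsets]
      congr 1
      refine List.ext_getElem (by simp [numSubsets]) fun m h1 h2 => ?_
      rw [List.length_map] at h2
      simp [subsetAt, h2]

/-! ### Reading instances -/

section Access

variable {k r p : ℕ} {R : ι → ThinRep k} {x : ι → Σ R : ThinRep k, Instance R r p}

theorem Decides.adj (hR : Computes e fun i => (R i).enc) {u v : ∀ i, Fin (R i).n}
    (hu : Computes e fun i => encNat (u i)) (hv : Computes e fun i => encNat (v i)) :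
    Decides e fun i => (R i).G.Adj (u i) (v i) :=
  of_ofProp (Computes.getD_ofFn (f := fun i v => Data.ofProp ((R i).G.Adj (u i) v))
    (Computes.getD_ofFn (f := fun i u => .ofFn fun v => .ofProp ((R i).G.Adj u v))
      (Computes.fst hR) hu) hv)

theorem Computes.range_vertices (hR : Computes e fun i => (R i).enc) :
    Computes e fun i => encList encNat (List.range (R i).n) :=
  range_of_ofFn (f := fun i u => .ofFn fun v => .ofProp ((R i).G.Adj u v)) (fst hR)

theorem Decides.matrix_eq_one {M : ι → Matrix (Fin r) (Fin r) Entry}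
    (hM : Computes e fun i => encMatrix (M i)) {j j' : ι → Fin r}
    (hj : Computes e fun i => encNat (j i)) (hj' : Computes e fun i => encNat (j' i)) :
    Decides e fun i => M i (j i) (j' i) = .one := by
  have h := Computes.getD_ofFn (f := fun i j' => (M i (j i) j').enc)
    (Computes.getD_ofFn (f := fun i j => .ofFn fun j' => (M i j j').enc) hM hj) hj'
  refine (val_le (.const (.num 1)) h).congr fun i => ?_
  cases M i (j i) (j' i) <;> simp [Entry.enc, Data.val]

theorem Decides.matrix_eq_zero {M : ι → Matrix (Fin r) (Fin r) Entry}
    (hM : Computes e fun i => encMatrix (M i)) {j j' : ι → Fin r}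
    (hj : Computes e fun i => encNat (j i)) (hj' : Computes e fun i => encNat (j' i)) :
    Decides e fun i => M i (j i) (j' i) = .zero := by
  have h := Computes.getD_ofFn (f := fun i j' => (M i (j i) j').enc)
    (Computes.getD_ofFn (f := fun i j => .ofFn fun j' => (M i j j').enc) hM hj) hj'
  -- The code `nil` of a star also has value `0` and has to be excluded separately.
  refine ((val_le h (.const (.num 0))).and (eq_nil h).not).congr fun i => ?_
  cases M i (j i) (j' i) <;> simp [Entry.enc, Data.val]

theorem Computes.rep (hx : Computes e fun i => (x i).2.enc) :
    Computes e fun i => (x i).1.enc := hx.fst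

theorem Computes.weight (hx : Computes e fun i => (x i).2.enc)
    {s : ∀ i, Fin (x i).2.t} {v : ∀ i, Fin (x i).1.n}
    (hs : Computes e fun i => encNat (s i)) (hv : Computes e fun i => encNat (v i)) :
    Computes e fun i => .num ((x i).2.w (s i) (v i)) :=
  getD_ofFn (f := fun i v => .num ((x i).2.w (s i) v))
    (getD_ofFn (f := fun i s => .ofFn fun v => .num ((x i).2.w s v)) hx.snd.fst hs) hv

theorem Computes.range_weights (hx : Computes e fun i => (x i).2.enc) :
    Computes e fun i => encList encNat (List.range (x i).2.t) :=
  range_of_ofFn (f := fun i s => .ofFn fun v => .num ((x i).2.w s v)) hx.snd.fst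

theorem Computes.coeff (hx : Computes e fun i => (x i).2.enc)
    {s : ∀ i, Fin (x i).2.t} {j : ι → Fin r}
    (hs : Computes e fun i => encNat (s i)) (hj : Computes e fun i => encNat (j i)) :
    Computes e fun i => .num ((x i).2.c (s i) (j i)) :=
  getD_ofFn (n := fun _ => r) (f := fun i j => .num ((x i).2.c (s i) j))
    (getD_ofFn (f := fun i s => .ofFn fun j => .num ((x i).2.c s j)) hx.snd.snd.fst hs) hj

theorem Decides.maximize (hx : Computes e fun i => (x i).2.enc) :
    Decides e fun i => (x i).2.maximize = true :=
  of_ofProp hx.snd.snd.snd.fst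

theorem Computes.intWeight (hx : Computes e fun i => (x i).2.enc)
    {s : ι → Fin p} {v : ∀ i, Fin (x i).1.n}
    (hs : Computes e fun i => encNat (s i)) (hv : Computes e fun i => encNat (v i)) :
    Computes e fun i => encNat ((x i).2.b (s i) (v i)) :=
  getD_ofFn (f := fun i v => .num ((x i).2.b (s i) v : ℚ))
    (getD_ofFn (f := fun i s => .ofFn fun v => .num ((x i).2.b s v : ℚ))
      hx.snd.snd.snd.snd.fst hs) hv

theorem Decides.mem_list (hx : Computes e fun i => (x i).2.enc)
    {v : ∀ i, Fin (x i).1.n} {a : ι → ℕ}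
    (hv : Computes e fun i => encNat (v i)) (ha : Computes e fun i => encNat (a i)) :
    Decides e fun i => subsetAt r (a i) ∈ (x i).2.L (v i) := by
  have h : Computes e fun i => .ofFamily fun J => .ofProp (J ∈ (x i).2.L (v i)) :=
    Computes.getD_ofFn (f := fun i v => .ofFamily fun J => .ofProp (J ∈ (x i).2.L v))
      hx.snd.snd.snd.snd.snd.fst hv
  -- `a i` may be out of range, so the subset with this number is looked up under its proper number.
  refine (exists_subset (P := fun i J => (J ⊆ subsetAt r (a i) ∧ subsetAt r (a i) ⊆ J) ∧
    J ∈ (x i).2.L (v i)) fun φ b he hb => ?_).congr fun i => ?_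
  · exact ((subsetAt_subset hb (ha.lift he)).and (subsetAt_subset (ha.lift he) hb)).and
      (of_ofProp (Computes.getD_ofFamily (h.lift he) hb))
  · constructor
    · rintro ⟨J, h, h'⟩
      rwa [← Finset.Subset.antisymm h.1 h.2]
    · exact fun h => ⟨_, ⟨subset_rfl, subset_rfl⟩, h⟩

theorem Computes.matrix (hx : Computes e fun i => (x i).2.enc) :
    Computes e fun i => encMatrix (x i).2.M :=
  hx.snd.snd.snd.snd.snd.snd.fst

theorem Decides.bounds {l : ι → Fin p → Finset (Fin r) → ℕ} {u : ι → Fin p → Finset (Fin r) → ℕ∞}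
    (hl : Computes e fun i => .ofFn fun s => .ofFamily fun J => .num (l i s J : ℚ))
    (hu : Computes e fun i => .ofFn fun s => .ofFamily fun J => .ofENat (u i s J))
    {s : ι → Fin p} {a : ι → Fin (numSubsets r)} {m : ι → ℕ}
    (hs : Computes e fun i => encNat (s i)) (ha : Computes e fun i => encNat (a i))
    (hm : Computes e fun i => encNat (m i)) :
    Decides e fun i => l i (s i) (subsetAt r (a i)) ≤ m i ∧
      (m i : ℕ∞) ≤ u i (s i) (subsetAt r (a i)) := by
  have hl' := Computes.getD_ofFamily (Computes.getD_ofFn (n := fun _ => p)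
    (f := fun i s => .ofFamily fun J => .num (l i s J : ℚ)) hl hs) ha
  have hu' := Computes.getD_ofFamily (Computes.getD_ofFn (n := fun _ => p)
    (f := fun i s => .ofFamily fun J => .ofENat (u i s J)) hu hs) ha
  -- An upper bound `∞` is coded by `nil`.
  refine (nat_le hl' hm).and (((eq_nil hu').or (val_le hm hu')).congr fun i => ?_)
  generalize u i (s i) (subsetAt r (a i)) = t
  cases t with
  | top => simp [Data.ofENat]
  | coe t => simp [Data.ofENat, Data.val, encNat]

end Access

/-! ### The stages of the framework problem -/

/-- The set of names of parts that contain the vertex `v`, according to a word `w` whose letters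
number the subsets chosen for the vertices `u, u + 1, …`. -/
def typeAt (r u : ℕ) (w : List ℕ) (v : ℕ) : Finset (Fin r) := subsetAt r (w.getD (v - u) 0)

theorem typeAt_cons_self (r u a : ℕ) (w : List ℕ) : typeAt r u (a :: w) u = subsetAt r a := by
  simp [typeAt]

theorem typeAt_cons_of_lt (r a : ℕ) (w : List ℕ) {u v : ℕ} (h : u < v) :
    typeAt r u (a :: w) v = typeAt r (u + 1) w v := by
  rw [typeAt, typeAt, show v - u = (v - (u + 1)) + 1 by omega, List.getD_cons_succ]

/-- A sum over the vertices `u, u + 1, …` of a quantity that depends on their types. -/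
def tailSum {A : Type} [AddCommMonoid A] {n r : ℕ} (g : Fin n → Finset (Fin r) → A) (u : ℕ)
    (w : List ℕ) : A :=
  ∑ v : Fin n, if u ≤ v then g v (typeAt r u w v) else 0

theorem tailSum_cons {A : Type} [AddCommMonoid A] {n r : ℕ} (g : Fin n → Finset (Fin r) → A)
    {u a : ℕ} {w : List ℕ} (hu : u < n) :
    tailSum g u (a :: w) = g ⟨u, hu⟩ (subsetAt r a) + tailSum g (u + 1) w := by
  have h (v : Fin n) : (if u ≤ v then g v (typeAt r u (a :: w) v) else 0) =
      (if v = ⟨u, hu⟩ then g v (subsetAt r a) else 0) +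
        if u + 1 ≤ v then g v (typeAt r (u + 1) w v) else 0 := by
    rcases lt_trichotomy u v with h | h | h
    · rw [if_pos h.le, if_neg (by rintro rfl; simp at h), if_pos (Nat.succ_le_of_lt h),
        typeAt_cons_of_lt _ _ _ h, zero_add]
    · obtain rfl : v = ⟨u, hu⟩ := Fin.ext h.symm
      simp [typeAt_cons_self]
    · rw [if_neg (by omega), if_neg (by rintro rfl; simp at h), if_neg (by omega), zero_add]
  rw [tailSum, Finset.sum_congr rfl fun v _ => h v, Finset.sum_add_distrib]
  simp [tailSum]

namespace Instance

variable {k r p : ℕ} {R : ThinRep k} (I : Instance R r p)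

/-- The choice of types for the vertices from `u` on that is given by `w` obeys the lists and the
adjacency conditions. As the matrix is symmetric, these are needed for `v ≤ v'` only. -/
def ValidFrom (u : ℕ) (w : List ℕ) : Prop :=
  ∀ v : Fin R.n, u ≤ v → typeAt r u w v ∈ I.L v ∧
    ∀ v' : Fin R.n, v ≤ v' → ∀ i j : Fin r, i ∈ typeAt r u w v → j ∈ typeAt r u w v' →
      (I.M i j = .one → v ≠ v' → R.G.Adj v v') ∧ (I.M i j = .zero → ¬ R.G.Adj v v')

/-- The weight `b s` of those vertices from `u` on whose type belongs to the family `F`. -/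
noncomputable def tailWeight (s : Fin p) (F : Set (Finset (Fin r))) (u : ℕ) (w : List ℕ) : ℕ :=
  open Classical in tailSum (fun v A => if A ∈ F then I.b s v else 0) u w

/-- The contribution to the objective of a vertex of type `A`, with the sign that turns the
optimization into a maximization. -/
def gain (v : Fin R.n) (A : Finset (Fin r)) : ℚ :=
  (if I.maximize = true then 1 else -1) *
    ∑ s : Fin I.t, ∑ j : Fin r, if j ∈ A then I.c s j * I.w s v else 0

/-- The sets given by a word. -/
def setsOf (n r : ℕ) (w : List ℕ) (j : Fin r) : Finset (Fin n) :=
  Finset.univ.filter fun v => j ∈ typeAt r 0 w v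

/-- The types that contain `J`: those of the vertices in the intersection of the sets `S j`,
`j ∈ J`. -/
def supersets (J : Finset (Fin r)) : Set (Finset (Fin r)) := {A | J ⊆ A}

/-- The types that meet `J`: those of the vertices in the union of the sets `S j`, `j ∈ J`. -/
def meeting (J : Finset (Fin r)) : Set (Finset (Fin r)) := {A | ∃ j ∈ J, j ∈ A}

/-- The bounds on the weights of intersections and unions hold for a word that describes all
vertices. -/
def BoundsHold (w : List ℕ) : Prop :=
  ∀ (s : Fin p) (J : Finset (Fin r)),
    (I.lowerInter s J ≤ I.tailWeight s (supersets J) 0 w ∧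
      (I.tailWeight s (supersets J) 0 w : ℕ∞) ≤ I.upperInter s J) ∧
    (I.lowerUnion s J ≤ I.tailWeight s (meeting J) 0 w ∧
      (I.tailWeight s (meeting J) 0 w : ℕ∞) ≤ I.upperUnion s J)

end Instance

/-- The vertices before `u` with a neighbour, at or after `u`, in the `i`-th set. -/
def touched {k : ℕ} (R : ThinRep k) {r : ℕ} (u : ℕ) (w : List ℕ) (i : Fin r) : Set (Fin R.n) :=
  {c | (c : ℕ) < u ∧ ∃ v : Fin R.n, u ≤ v ∧ i ∈ typeAt r u w v ∧ R.G.Adj v c}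

/-- The vertices before `u` that are adjacent to all vertices of the `i`-th set from `u` on. -/
def dominating {k : ℕ} (R : ThinRep k) {r : ℕ} (u : ℕ) (w : List ℕ) (i : Fin r) : Set (Fin R.n) :=
  {c | (c : ℕ) < u ∧ ∀ v : Fin R.n, u ≤ v → i ∈ typeAt r u w v → R.G.Adj v c}

namespace Instance

variable {k r p : ℕ} {R : ThinRep k} (I : Instance R r p)

/-- What the choice of types for the vertices from `u` on means for the vertices before `u` and for
the bounds. -/
noncomputable def signature (u : ℕ) (w : List ℕ) :
    ((Fin r → Set (Fin R.n)) × (Fin r → Set (Fin R.n))) ×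
      (Fin p → Finset (Fin r) → ℕ) × (Fin p → Finset (Fin r) → ℕ) :=
  ((touched R u w, dominating R u w),
    fun s J => I.tailWeight s (supersets J) u w, fun s J => I.tailWeight s (meeting J) u w)

theorem touched_cons {u a : ℕ} {w : List ℕ} (hu : u < R.n) (i : Fin r) :
    touched R u (a :: w) i = {c : Fin R.n | (c : ℕ) < u ∧
      (i ∈ subsetAt r a ∧ R.G.Adj ⟨u, hu⟩ c ∨ c ∈ touched R (u + 1) w i)} := by
  ext c
  refine and_congr_right fun hc => ⟨?_, ?_⟩
  · rintro ⟨v, huv, hi, hv⟩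
    rcases huv.eq_or_lt with h | h
    · obtain rfl : v = ⟨u, hu⟩ := Fin.ext h.symm
      rw [typeAt_cons_self] at hi
      exact Or.inl ⟨hi, hv⟩
    · rw [typeAt_cons_of_lt _ _ _ h] at hi
      exact Or.inr ⟨by omega, v, h, hi, hv⟩
  · rintro (⟨hi, hv⟩ | ⟨_, v, huv, hi, hv⟩)
    · exact ⟨⟨u, hu⟩, le_rfl, by rwa [typeAt_cons_self], hv⟩
    · exact ⟨v, by omega, by rwa [typeAt_cons_of_lt _ _ _ huv], hv⟩

theorem dominating_cons {u a : ℕ} {w : List ℕ} (hu : u < R.n) (i : Fin r) :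
    dominating R u (a :: w) i = {c : Fin R.n | (c : ℕ) < u ∧
      ((i ∈ subsetAt r a → R.G.Adj ⟨u, hu⟩ c) ∧ c ∈ dominating R (u + 1) w i)} := by
  ext c
  refine and_congr_right fun hc => ⟨fun h => ⟨fun hi => ?_, by omega, fun v huv hi => ?_⟩, ?_⟩
  · exact h ⟨u, hu⟩ le_rfl (by rwa [typeAt_cons_self])
  · exact h v (by omega) (by rwa [typeAt_cons_of_lt _ _ _ huv])
  · rintro ⟨h1, _, h2⟩ v huv hi
    rcases huv.eq_or_lt with h | h
    · obtain rfl : v = ⟨u, hu⟩ := Fin.ext h.symm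
      rw [typeAt_cons_self] at hi
      exact h1 hi
    · rw [typeAt_cons_of_lt _ _ _ h] at hi
      exact h2 v h hi

theorem validFrom_tail {u a : ℕ} {w : List ℕ} (h : I.ValidFrom u (a :: w)) :
    I.ValidFrom (u + 1) w := by
  intro v hv
  obtain ⟨h1, h2⟩ := h v (by omega)
  rw [typeAt_cons_of_lt _ _ _ hv] at h1 h2
  refine ⟨h1, fun v' hv' i j hi hj => h2 v' hv' i j hi ?_⟩
  rwa [typeAt_cons_of_lt _ _ _ (Nat.lt_of_lt_of_le hv hv')]

/-- Whether a type can be chosen for the vertex `u` depends only on the signature of the choices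
made for the later vertices. -/
theorem validFrom_congr {u a : ℕ} {w w' : List ℕ} (hu : u < R.n)
    (hs : I.signature (u + 1) w = I.signature (u + 1) w') (hw' : I.ValidFrom (u + 1) w')
    (h : I.ValidFrom u (a :: w)) : I.ValidFrom u (a :: w') := by
  have ht (j) : touched R (u + 1) w j = touched R (u + 1) w' j :=
    congrFun (congrArg (fun s => s.1.1) hs) j
  have hd (j) : dominating R (u + 1) w j = dominating R (u + 1) w' j :=
    congrFun (congrArg (fun s => s.1.2) hs) j
  intro v hv
  rcases hv.eq_or_lt with hv | hv
  · obtain rfl : v = ⟨u, hu⟩ := Fin.ext hv.symm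
    obtain ⟨h1, h2⟩ := h ⟨u, hu⟩ le_rfl
    simp only [typeAt_cons_self] at h1 h2 ⊢
    refine ⟨h1, fun v' hv' i j hi hj => ?_⟩
    rcases hv'.eq_or_lt with rfl | hv'
    · exact h2 _ le_rfl i j hi (by simpa only [typeAt_cons_self] using hj)
    · replace hv' : u < v' := hv'
      rw [typeAt_cons_of_lt _ _ _ hv'] at hj
      refine ⟨fun hM _ => ?_, fun hM hadj => ?_⟩
      · have hmem : (⟨u, hu⟩ : Fin R.n) ∈ dominating R (u + 1) w j := by
          refine ⟨Nat.lt_succ_self u, fun v'' hv'' hj'' => ?_⟩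
          refine ((h2 v'' (by simp only [Fin.le_def]; omega) i j hi ?_).1 hM ?_).symm
          · rwa [typeAt_cons_of_lt _ _ _ hv'']
          · rintro rfl
            simp at hv''
        rw [hd] at hmem
        exact (hmem.2 v' hv' hj).symm
      · have hmem : (⟨u, hu⟩ : Fin R.n) ∈ touched R (u + 1) w' j :=
          ⟨Nat.lt_succ_self u, v', hv', hj, hadj.symm⟩
        rw [← ht] at hmem
        obtain ⟨_, v'', hv'', hj'', hadj''⟩ := hmem
        refine (h2 v'' (by simp only [Fin.le_def]; omega) i j hi ?_).2 hM hadj''.symm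
        rwa [typeAt_cons_of_lt _ _ _ hv'']
  · obtain ⟨h1, h2⟩ := hw' v hv
    rw [typeAt_cons_of_lt _ _ _ hv]
    refine ⟨h1, fun v' hv' i j hi hj => h2 v' hv' i j hi ?_⟩
    rwa [typeAt_cons_of_lt _ _ _ (Nat.lt_of_lt_of_le hv hv')] at hj

theorem signature_congr {u a : ℕ} {w w' : List ℕ} (hu : u < R.n)
    (hs : I.signature (u + 1) w = I.signature (u + 1) w') :
    I.signature u (a :: w) = I.signature u (a :: w') := by
  simp only [signature, Prod.mk.injEq] at hs ⊢
  obtain ⟨⟨h1, h2⟩, h3, h4⟩ := hs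
  refine ⟨⟨?_, ?_⟩, ?_, ?_⟩
  · funext i
    rw [touched_cons hu, touched_cons hu, h1]
  · funext i
    rw [dominating_cons hu, dominating_cons hu, h2]
  · funext s J
    have := congrFun (congrFun h3 s) J
    simp only [tailWeight, tailSum_cons _ hu] at this ⊢
    rw [this]
  · funext s J
    have := congrFun (congrFun h4 s) J
    simp only [tailWeight, tailSum_cons _ hu] at this ⊢
    rw [this]

/-- The dynamic program for an instance of the framework: the vertices are treated from the last to
the first. -/
noncomputable def stages : Stages R.n where
  X := _
  valid := I.ValidFrom
  sig := I.signature
  val := tailSum I.gain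
  cost u a := if h : u < R.n then I.gain ⟨u, h⟩ (subsetAt r a) else 0
  final := I.BoundsHold
  valid_nil v hv := absurd v.2 (not_lt.2 hv)
  valid_tail _ h := I.validFrom_tail h
  valid_congr := I.validFrom_congr
  sig_congr := I.signature_congr
  val_cons hu := by rw [tailSum_cons _ hu, dif_pos hu]
  final_congr {w w'} hs h := by
    intro s J
    have h1 : I.tailWeight s (supersets J) 0 w = I.tailWeight s (supersets J) 0 w' :=
      congrFun (congrFun (congrArg (fun s => s.2.1) hs) s) J
    have h2 : I.tailWeight s (meeting J) 0 w = I.tailWeight s (meeting J) 0 w' :=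
      congrFun (congrFun (congrArg (fun s => s.2.2) hs) s) J
    rw [← h1, ← h2]
    exact h s J

/-! ### The number of signatures -/

/-- A set of vertices before `u` that is closed upwards within the classes is given by one threshold
for each class. -/
theorem exists_threshold {u : ℕ} {A : Set (Fin R.n)} (hA : ∀ c ∈ A, (c : ℕ) < u)
    (hup : ∀ c c' : Fin R.n, c ∈ A → c < c' → (c' : ℕ) < u → R.cls c = R.cls c' → c' ∈ A) :
    ∃ θ : Fin k → Fin (R.n + 1), A = {c : Fin R.n | (c : ℕ) < u ∧ (θ (R.cls c) : ℕ) ≤ c} := by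
  classical
  have h (κ : Fin k) : ∃ t : Fin (R.n + 1), ∀ c : Fin R.n, R.cls c = κ →
      (c ∈ A ↔ (c : ℕ) < u ∧ (t : ℕ) ≤ c) := by
    by_cases hex : ∃ m, ∃ c : Fin R.n, (c : ℕ) = m ∧ c ∈ A ∧ R.cls c = κ
    · obtain ⟨c₀, h0, h1, h2⟩ := Nat.find_spec hex
      refine ⟨⟨Nat.find hex, by omega⟩, fun c hc => ⟨fun h => ⟨hA c h, ?_⟩, fun h => ?_⟩⟩
      · exact Nat.find_min' hex ⟨c, rfl, h, hc⟩
      · rcases (Fin.le_def.2 (h0.trans_le h.2)).eq_or_lt with rfl | hlt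
        · exact h1
        · exact hup c₀ c h1 hlt h.1 (h2.trans hc.symm)
    · refine ⟨Fin.last _, fun c hc => ⟨fun h => absurd ⟨c, c, rfl, h, hc⟩ hex, fun h => ?_⟩⟩
      have := h.2
      simp only [Fin.val_last] at this
      omega
  choose θ hθ using h
  exact ⟨θ, Set.ext fun c => hθ _ c rfl⟩

theorem exists_threshold_touched (u : ℕ) (w : List ℕ) (i : Fin r) :
    ∃ θ : Fin k → Fin (R.n + 1),
      touched R u w i = {c : Fin R.n | (c : ℕ) < u ∧ (θ (R.cls c) : ℕ) ≤ c} :=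
  exists_threshold (fun _ h => h.1) fun c c' ⟨_, v, hv, hi, hadj⟩ hcc hc' hcls =>
    ⟨hc', v, hv, hi, R.consistent c c' v hcc (Fin.lt_def.2 (hc'.trans_le hv)) hcls hadj⟩

theorem exists_threshold_dominating (u : ℕ) (w : List ℕ) (i : Fin r) :
    ∃ θ : Fin k → Fin (R.n + 1),
      dominating R u w i = {c : Fin R.n | (c : ℕ) < u ∧ (θ (R.cls c) : ℕ) ≤ c} :=
  exists_threshold (fun _ h => h.1) fun c c' h hcc hc' hcls =>
    ⟨hc', fun v hv hi => R.consistent c c' v hcc (Fin.lt_def.2 (hc'.trans_le hv)) hcls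
      (h.2 v hv hi)⟩

theorem tailWeight_le {C : ℕ} (hb : ∀ s v, I.b s v ≤ C) (s : Fin p) (F : Set (Finset (Fin r)))
    (u : ℕ) (w : List ℕ) : I.tailWeight s F u w ≤ R.n * C := by
  have h := Finset.sum_le_card_nsmul (Finset.univ : Finset (Fin R.n))
    (fun v => if u ≤ v then (open Classical in if typeAt r u w v ∈ F then I.b s v else 0) else 0)
    C fun v _ => ?_
  · simpa [tailWeight, tailSum] using h
  split_ifs
  · exact hb s v
  · exact Nat.zero_le _
  · exact Nat.zero_le _

/-- Consistency of the order with the classes makes the number of signatures polynomial in the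
number of vertices. -/
theorem length_le_of_nodup_signature {C : ℕ} (hb : ∀ s v, I.b s v ≤ C) (u : ℕ)
    (l : List (List ℕ)) (hl : (l.map (I.signature u)).Nodup) :
    l.length ≤ (((R.n + 1) ^ k) ^ r) ^ 2 * (((R.n * C + 1) ^ 2 ^ r) ^ p) ^ 2 := by
  let Θ := ((Fin r → Fin k → Fin (R.n + 1)) × (Fin r → Fin k → Fin (R.n + 1))) ×
    (Fin p → Finset (Fin r) → Fin (R.n * C + 1)) × (Fin p → Finset (Fin r) → Fin (R.n * C + 1))
  let A (θ : Fin k → Fin (R.n + 1)) : Set (Fin R.n) :=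
    {c | (c : ℕ) < u ∧ (θ (R.cls c) : ℕ) ≤ c}
  let Φ : Θ → _ := fun θ => ((fun i => A (θ.1.1 i), fun i => A (θ.1.2 i)),
    fun s J => (θ.2.1 s J : ℕ), fun s J => (θ.2.2 s J : ℕ))
  -- A signature is determined by thresholds for the two families of sets and by bounded weights.
  choose f hf using exists_threshold_touched (R := R) (r := r) u
  choose g hg using exists_threshold_dominating (R := R) (r := r) u
  have hle := I.tailWeight_le hb
  let θ (w : List ℕ) : Θ := ((f w, g w),
    fun s J => ⟨I.tailWeight s (supersets J) u w, Nat.lt_succ_of_le (hle _ _ _ _)⟩,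
    fun s J => ⟨I.tailWeight s (meeting J) u w, Nat.lt_succ_of_le (hle _ _ _ _)⟩)
  have hθ : I.signature u = Φ ∘ θ := by
    funext w
    simp only [signature, Function.comp, Φ, θ, A, Prod.mk.injEq, and_true]
    exact ⟨funext fun i => hf w i, funext fun i => hg w i⟩
  rw [hθ, ← List.map_map] at hl
  have := hl.of_map.length_le_card
  simpa [Θ, sq] using this

/-! ### Solutions and words -/

/-- Every family of sets is given by a word. -/
theorem exists_setsOf (n : ℕ) (S : Fin r → Finset (Fin n)) :
    ∃ w : List ℕ, w.length = n ∧ (∀ a ∈ w, a < numSubsets r) ∧ setsOf n r w = S := by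
  choose f hf hf' using exists_subsetAt (r := r)
  refine ⟨List.ofFn fun v => f (Finset.univ.filter fun j => v ∈ S j), by simp, ?_, ?_⟩
  · simp only [List.mem_ofFn]
    rintro _ ⟨v, rfl⟩
    exact hf _
  · funext j
    ext v
    simp [setsOf, typeAt, hf']

theorem filter_mem_setsOf (w : List ℕ) (v : Fin R.n) :
    (Finset.univ.filter fun j => v ∈ setsOf R.n r w j) = typeAt r 0 w v := by
  ext j
  simp [setsOf]

theorem feasible_setsOf (w : List ℕ) :
    I.Feasible (setsOf R.n r w) ↔ I.ValidFrom 0 w ∧ I.BoundsHold w := by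
  have hi (s J) : ∑ v ∈ inter (setsOf R.n r w) J, I.b s v = I.tailWeight s (supersets J) 0 w := by
    rw [inter, Finset.sum_filter]
    simp [tailWeight, tailSum, supersets, setsOf, Finset.subset_iff]
  have hu (s J) : ∑ v ∈ union (setsOf R.n r w) J, I.b s v = I.tailWeight s (meeting J) 0 w := by
    rw [union, Finset.sum_filter]
    simp only [tailWeight, tailSum, meeting, setsOf, Nat.zero_le, if_true, Finset.mem_filter,
      Finset.mem_univ, true_and, Set.mem_ofPred_eq]
    exact Finset.sum_congr rfl fun v _ => by congr
  constructor
  · rintro ⟨h1, h2, h3, h4⟩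
    refine ⟨fun v _ => ⟨?_, fun v' _ i j hi hj => ?_⟩, fun s J => ?_⟩
    · have := h1 v
      rwa [filter_mem_setsOf] at this
    · have hv : v ∈ setsOf R.n r w i := by simpa [setsOf] using hi
      have hv' : v' ∈ setsOf R.n r w j := by simpa [setsOf] using hj
      exact ⟨fun hM hne => (h2 i j).1 hM v hv v' hv' hne, fun hM => (h2 i j).2 hM v hv v' hv'⟩
    · rw [← hi, ← hu]
      exact ⟨h3 s J, h4 s J⟩
  · rintro ⟨h1, h2⟩
    have h5 (i j : Fin r) (v v' : Fin R.n) (hv : v ∈ setsOf R.n r w i)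
        (hv' : v' ∈ setsOf R.n r w j) :
        (I.M i j = .one → v ≠ v' → R.G.Adj v v') ∧ (I.M i j = .zero → ¬ R.G.Adj v v') := by
      simp only [setsOf, Finset.mem_filter, Finset.mem_univ, true_and] at hv hv'
      rcases le_total v v' with h | h
      · exact (h1 v (Nat.zero_le _)).2 v' h i j hv hv'
      · have := (h1 v' (Nat.zero_le _)).2 v h j i hv' hv
        rw [I.M_symm.apply i j] at this
        exact ⟨fun hM hne => (this.1 hM hne.symm).symm, fun hM hadj => this.2 hM hadj.symm⟩
    refine ⟨fun v => ?_, fun i j => ⟨fun hM v hv v' hv' => (h5 i j v v' hv hv').1 hM,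
      fun hM v hv v' hv' => (h5 i j v v' hv hv').2 hM⟩, fun s J => ?_, fun s J => ?_⟩
    · rw [filter_mem_setsOf]
      exact (h1 v (Nat.zero_le _)).1
    · rw [hi]
      exact (h2 s J).1
    · rw [hu]
      exact (h2 s J).2

theorem tailSum_gain (w : List ℕ) : tailSum I.gain 0 w =
    (if I.maximize = true then 1 else -1) * I.value (setsOf R.n r w) := by
  simp only [tailSum, gain, Nat.zero_le, if_true, ← Finset.mul_sum, Objective.value]
  congr 1
  rw [Finset.sum_comm]
  refine Finset.sum_congr rfl fun s _ => ?_
  rw [Finset.sum_comm]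
  refine Finset.sum_congr rfl fun j _ => ?_
  rw [Finset.mul_sum, setsOf, Finset.sum_filter]

/-- The dynamic program finds an optimal family of sets, or shows that none is feasible. -/
theorem solution_spec :
    (I.stages.solution (numSubsets r) = [] ∧ ∀ S, ¬ I.Optimal S) ∨
    ∃ w, I.stages.solution (numSubsets r) = [w] ∧ I.Optimal (setsOf R.n r w) := by
  rcases I.stages.solution_spec (numSubsets r) with ⟨h, hn⟩ | ⟨w, h, hw, hf, hopt⟩
  · refine Or.inl ⟨h, fun S hS => ?_⟩
    obtain ⟨w, h1, h2, rfl⟩ := exists_setsOf R.n S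
    have hfeas := I.feasible_setsOf w |>.1 hS.1
    exact hn w ⟨h1, h2, hfeas.1⟩ hfeas.2
  · refine Or.inr ⟨w, h, (I.feasible_setsOf w).2 ⟨hw.2.2, hf⟩, fun S' hS' => ?_⟩
    obtain ⟨w', h1, h2, rfl⟩ := exists_setsOf R.n S'
    have hfeas := I.feasible_setsOf w' |>.1 hS'
    have hle : tailSum I.gain 0 w' ≤ tailSum I.gain 0 w := hopt w' ⟨h1, h2, hfeas.1⟩ hfeas.2
    rw [tailSum_gain, tailSum_gain] at hle
    split_ifs at hle ⊢ <;> linarith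

end Instance

/-! ### The dynamic program runs in polynomial time -/

section

variable {ι : Type} {e : ι → Data} {k r p : ℕ} {x : ι → Σ R : ThinRep k, Instance R r p}

theorem Computes.typeIndex {u v : ι → ℕ} {w : ι → List ℕ} (hu : Computes e fun i => encNat (u i))
    (hw : Computes e fun i => encList encNat (w i)) (hv : Computes e fun i => encNat (v i)) :
    Computes e fun i => encNat ((w i).getD (v i - u i) 0) :=
  encNat_getD hw (encNat_sub hv hu)

theorem Decides.mem_typeAt {u v : ι → ℕ} {w : ι → List ℕ} {j : ι → Fin r}
    (hu : Computes e fun i => encNat (u i)) (hw : Computes e fun i => encList encNat (w i))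
    (hv : Computes e fun i => encNat (v i)) (hj : Computes e fun i => encNat (j i)) :
    Decides e fun i => j i ∈ typeAt r (u i) (w i) (v i) :=
  mem_subsetAt hj (.typeIndex hu hw hv)

theorem Decides.validFrom {u : ι → ℕ} {w : ι → List ℕ} (hx : Computes e fun i => (x i).2.enc)
    (hu : Computes e fun i => encNat (u i)) (hw : Computes e fun i => encList encNat (w i)) :
    Decides e fun i => (x i).2.ValidFrom (u i) (w i) := by
  refine Computes.forall_fin (Computes.range_vertices hx.rep) fun φ v he hv => ?_
  replace hx := hx.lift he
  replace hu := hu.lift he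
  replace hw := hw.lift he
  refine (nat_le hu hv).imp ((mem_list hx hv (.typeIndex hu hw hv)).and ?_)
  refine Computes.forall_fin (Computes.range_vertices hx.rep) fun φ v' he hv' => ?_
  replace hx := hx.lift he
  replace hu := hu.lift he
  replace hw := hw.lift he
  replace hv := hv.lift he
  refine ((nat_le hv hv').congr fun _ => Fin.le_def.symm).imp ?_
  refine Computes.forall_fin (n := fun _ => r) (.range_const r) fun φ i he hi => ?_
  replace hx := hx.lift he
  replace hu := hu.lift he
  replace hw := hw.lift he
  replace hv := hv.lift he
  replace hv' := hv'.lift he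
  refine Computes.forall_fin (n := fun _ => r) (.range_const r) fun φ j he hj => ?_
  replace hx := hx.lift he
  replace hu := hu.lift he
  replace hw := hw.lift he
  replace hv := hv.lift he
  replace hv' := hv'.lift he
  replace hi := hi.lift he
  have hadj := adj hx.rep hv hv'
  exact (mem_typeAt hu hw hv hi).imp ((mem_typeAt hu hw hv' hj).imp
    (((matrix_eq_one hx.matrix hi hj).imp
      (((nat_eq hv hv').congr fun _ => Fin.ext_iff.symm).not.imp hadj)).and
      ((matrix_eq_zero hx.matrix hi hj).imp hadj.not)))

theorem Computes.tailSum {n : ι → ℕ} {g : ∀ i, Fin (n i) → Finset (Fin r) → ℚ}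
    {u : ι → ℕ} {w : ι → List ℕ}
    (hn : Computes e fun i => encList encNat (List.range (n i)))
    (hu : Computes e fun i => encNat (u i)) (hw : Computes e fun i => encList encNat (w i))
    (hg : ∀ {κ : Type} {e' : κ → Data} (φ : κ → ι) (v : ∀ x, Fin (n (φ x))) (a : κ → ℕ),
      Computes e' (fun x => e (φ x)) → Computes e' (fun x => encNat (v x)) →
      Computes e' (fun x => encNat (a x)) →
      Computes e' fun x => .num (g (φ x) (v x) (subsetAt r (a x)))) :
    Computes e fun i => .num (tailSum (g i) (u i) (w i)) := by
  refine sum hn fun φ v he hv => ?_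
  refine (ite (Decides.nat_le (hu.lift he) hv)
    (hg φ v _ he hv (typeIndex (hu.lift he) (hw.lift he) hv)) (const (.num 0))).congr fun x => ?_
  split_ifs <;> rfl

theorem Computes.tailWeight {s : ι → Fin p} {F : ι → Set (Finset (Fin r))} {u : ι → ℕ}
    {w : ι → List ℕ} (hx : Computes e fun i => (x i).2.enc)
    (hs : Computes e fun i => encNat (s i)) (hu : Computes e fun i => encNat (u i))
    (hw : Computes e fun i => encList encNat (w i))
    (hF : ∀ {κ : Type} {e' : κ → Data} (φ : κ → ι) (a : κ → ℕ),
      Computes e' (fun x => e (φ x)) → Computes e' (fun x => encNat (a x)) →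
      Decides e' fun x => subsetAt r (a x) ∈ F (φ x)) :
    Computes e fun i => encNat ((x i).2.tailWeight (s i) (F i) (u i) (w i)) := by
  classical
  have h : Computes e fun i => .num (Thin.tailSum
      (fun v A => if A ∈ F i then ((x i).2.b (s i) v : ℚ) else 0) (u i) (w i)) :=
    tailSum (range_vertices hx.rep) hu hw fun φ v a he hv ha =>
      (ite (hF φ a he ha) (intWeight (hx.lift he) (hs.lift he) hv) (const (encNat 0))).congr
        fun x => by split_ifs <;> simp [encNat]
  refine h.congr fun i => ?_
  simp only [Instance.tailWeight, Thin.tailSum, encNat]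
  push_cast
  congr!

theorem Decides.mem_supersets {a b : ι → ℕ} (ha : Computes e fun i => encNat (a i))
    (hb : Computes e fun i => encNat (b i)) :
    Decides e fun i => subsetAt r (a i) ∈ Instance.supersets (subsetAt r (b i)) :=
  subsetAt_subset hb ha

theorem Decides.mem_meeting {a b : ι → ℕ} (ha : Computes e fun i => encNat (a i))
    (hb : Computes e fun i => encNat (b i)) :
    Decides e fun i => subsetAt r (a i) ∈ Instance.meeting (subsetAt r (b i)) :=
  Computes.exists_fin (n := fun _ => r) (Computes.range_const r) fun _ _ he hj =>
    (mem_subsetAt hj (hb.lift he)).and (mem_subsetAt hj (ha.lift he))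

theorem Decides.mem_touched {u : ι → ℕ} {w : ι → List ℕ} {j : ι → Fin r}
    {c : ∀ i, Fin (x i).1.n} (hx : Computes e fun i => (x i).2.enc)
    (hu : Computes e fun i => encNat (u i)) (hw : Computes e fun i => encList encNat (w i))
    (hj : Computes e fun i => encNat (j i)) (hc : Computes e fun i => encNat (c i)) :
    Decides e fun i => c i ∈ touched (x i).1 (u i) (w i) (j i) :=
  (nat_le hu hc).not.congr (fun _ => not_le) |>.and <|
    Computes.exists_fin (Computes.range_vertices hx.rep) fun _ _ he hv =>
      (nat_le (hu.lift he) hv).and ((mem_typeAt (hu.lift he) (hw.lift he) hv (hj.lift he)).and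
        (adj (hx.lift he).rep hv (hc.lift he)))

theorem Decides.mem_dominating {u : ι → ℕ} {w : ι → List ℕ} {j : ι → Fin r}
    {c : ∀ i, Fin (x i).1.n} (hx : Computes e fun i => (x i).2.enc)
    (hu : Computes e fun i => encNat (u i)) (hw : Computes e fun i => encList encNat (w i))
    (hj : Computes e fun i => encNat (j i)) (hc : Computes e fun i => encNat (c i)) :
    Decides e fun i => c i ∈ dominating (x i).1 (u i) (w i) (j i) :=
  (nat_le hu hc).not.congr (fun _ => not_le) |>.and <|
    Computes.forall_fin (Computes.range_vertices hx.rep) fun _ _ he hv =>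
      (nat_le (hu.lift he) hv).imp ((mem_typeAt (hu.lift he) (hw.lift he) hv (hj.lift he)).imp
        (adj (hx.lift he).rep hv (hc.lift he)))

theorem Decides.signature_eq {u : ι → ℕ} {w w' : ι → List ℕ}
    (hx : Computes e fun i => (x i).2.enc) (hu : Computes e fun i => encNat (u i))
    (hw : Computes e fun i => encList encNat (w i))
    (hw' : Computes e fun i => encList encNat (w' i)) :
    Decides e fun i => (x i).2.signature (u i) (w i) = (x i).2.signature (u i) (w' i) := by
  have h1 : Decides e fun i => ∀ (j : Fin r) (c : Fin (x i).1.n),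
      ((c ∈ touched (x i).1 (u i) (w i) j ↔ c ∈ touched (x i).1 (u i) (w' i) j) ∧
        (c ∈ dominating (x i).1 (u i) (w i) j ↔ c ∈ dominating (x i).1 (u i) (w' i) j)) := by
    refine Computes.forall_fin (n := fun _ => r) (.range_const r) fun φ j he hj => ?_
    replace hx := hx.lift he
    replace hu := hu.lift he
    replace hw := hw.lift he
    replace hw' := hw'.lift he
    refine Computes.forall_fin (Computes.range_vertices hx.rep) fun φ c he hc => ?_
    replace hx := hx.lift he
    replace hu := hu.lift he
    replace hw := hw.lift he
    replace hw' := hw'.lift he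
    replace hj := hj.lift he
    exact ((mem_touched hx hu hw hj hc).iff (mem_touched hx hu hw' hj hc)).and
      ((mem_dominating hx hu hw hj hc).iff (mem_dominating hx hu hw' hj hc))
  have h2 : Decides e fun i => ∀ (s : Fin p) (J : Finset (Fin r)),
      (x i).2.tailWeight s (Instance.supersets J) (u i) (w i) =
        (x i).2.tailWeight s (Instance.supersets J) (u i) (w' i) ∧
      (x i).2.tailWeight s (Instance.meeting J) (u i) (w i) =
        (x i).2.tailWeight s (Instance.meeting J) (u i) (w' i) := by
    refine Computes.forall_fin (n := fun _ => p) (.range_const p) fun φ s he hs => ?_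
    replace hx := hx.lift he
    replace hu := hu.lift he
    replace hw := hw.lift he
    replace hw' := hw'.lift he
    refine forall_subset fun φ a he ha => ?_
    replace hx := hx.lift he
    replace hu := hu.lift he
    replace hw := hw.lift he
    replace hw' := hw'.lift he
    replace hs := hs.lift he
    exact (nat_eq
      (.tailWeight hx hs hu hw fun φ b he hb => mem_supersets hb (ha.lift he))
      (.tailWeight hx hs hu hw' fun φ b he hb => mem_supersets hb (ha.lift he))).and (nat_eq
      (.tailWeight hx hs hu hw fun φ b he hb => mem_meeting hb (ha.lift he))
      (.tailWeight hx hs hu hw' fun φ b he hb => mem_meeting hb (ha.lift he)))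
  refine (h1.and h2).congr fun i => ?_
  simp only [Instance.signature, Prod.mk.injEq, funext_iff, Set.ext_iff, forall_and]

theorem Computes.gain {v : ∀ i, Fin (x i).1.n} {a : ι → ℕ}
    (hx : Computes e fun i => (x i).2.enc) (hv : Computes e fun i => encNat (v i))
    (ha : Computes e fun i => encNat (a i)) :
    Computes e fun i => .num ((x i).2.gain (v i) (subsetAt r (a i))) := by
  have h1 : Computes e fun i => if (x i).2.maximize = true then Data.num 1 else .num (-1) :=
    ite (Decides.maximize hx) (const _) (const _)
  have h2 : Computes e fun i => .num (∑ s : Fin (x i).2.t, ∑ j : Fin r,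
      if j ∈ subsetAt r (a i) then (x i).2.c s j * (x i).2.w s (v i) else 0) := by
    refine sum (range_weights hx) fun φ s he hs => ?_
    replace hx := hx.lift he
    replace hv := hv.lift he
    replace ha := ha.lift he
    refine sum (n := fun _ => r) (range_const r) fun φ j he hj => ?_
    replace hx := hx.lift he
    replace hv := hv.lift he
    replace ha := ha.lift he
    replace hs := hs.lift he
    exact (ite (Decides.mem_subsetAt hj ha) ((coeff hx hs hj).mul (weight hx hs hv))
      (const (.num 0))).congr fun x => by split_ifs <;> simp [Data.val]
  refine (h1.mul h2).congr fun i => ?_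
  rw [Instance.gain]
  split_ifs <;> rfl

theorem Decides.boundsHold {w : ι → List ℕ} (hx : Computes e fun i => (x i).2.enc)
    (hw : Computes e fun i => encList encNat (w i)) :
    Decides e fun i => (x i).2.BoundsHold (w i) := by
  refine Computes.forall_fin (n := fun _ => p) (.range_const p) fun ψ s he hs => ?_
  replace hx := hx.lift he
  replace hw := hw.lift he
  refine forall_subset fun φ a he ha => ?_
  replace hx := hx.lift he
  replace hw := hw.lift he
  replace hs := hs.lift he
  exact (bounds (l := fun y => (x (ψ (φ y))).2.lowerInter) hx.snd.snd.snd.snd.snd.snd.snd.fst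
    hx.snd.snd.snd.snd.snd.snd.snd.snd.fst hs ha
    (.tailWeight hx hs (.const (encNat 0)) hw fun φ b he hb => mem_supersets hb (ha.lift he))).and
    (bounds (l := fun y => (x (ψ (φ y))).2.lowerUnion) hx.snd.snd.snd.snd.snd.snd.snd.snd.snd.fst
    hx.snd.snd.snd.snd.snd.snd.snd.snd.snd.snd.fst hs ha
    (.tailWeight hx hs (.const (encNat 0)) hw fun φ b he hb => mem_meeting hb (ha.lift he)))

end

/-- The solution of the framework computed by the dynamic program, as it is to be returned. -/
noncomputable def Instance.answer {k r p : ℕ} {R : ThinRep k} (I : Instance R r p) : Data :=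
  open Classical in
  if encList (encList encNat) (I.stages.solution (numSubsets r)) = .nil then .nil
  else .cons (.num 1)
    (encSets (Instance.setsOf R.n r ((I.stages.solution (numSubsets r)).headD [])))

section

variable {ι : Type} {e : ι → Data} {k r p : ℕ} {x : ι → Σ R : ThinRep k, Instance R r p}

theorem Computes.stages_solution (q : Polynomial ℕ) (hx : Computes e fun i => (x i).2.enc)
    (hb : ∀ i s v, (x i).2.b s v ≤ q.eval (x i).1.n) :
    Computes e fun i =>
      encList (encList encNat) ((x i).2.stages.solution (numSubsets r)) := by
  have hn := range_vertices hx.rep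
  refine solution (fun i => (x i).2.stages) (numSubsets r) hn
    (fun φ u w he hu hw => Decides.validFrom (hx.lift he) hu hw)
    (fun φ u w w' he hu hw hw' => Decides.signature_eq (hx.lift he) hu hw hw')
    (fun φ u w he hu hw => tailSum (hn.lift he) hu hw
      fun ψ v a he' hv ha => gain ((hx.lift he).lift he') hv ha)
    (fun φ w he hw => Decides.boundsHold (hx.lift he) hw) ?_
  have hsize : PolyBdd e fun i => (x i).1.n :=
    hn.polyBdd_size.mono fun i => by
      have h := length_le_size_encList encNat (List.range (x i).1.n)
      rwa [List.length_range] at h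
  have h1 := hsize.add (.const 1)
  have h2 := (hsize.mul (hsize.eval q)).add (.const 1)
  exact ⟨_, (((h1.pow k).pow r).pow 2).mul (((h2.pow (2 ^ r)).pow p).pow 2),
    fun i u _ l hl => (x i).2.length_le_of_nodup_signature (hb i) u l hl⟩

theorem Computes.answer (q : Polynomial ℕ) (hx : Computes e fun i => (x i).2.enc)
    (hb : ∀ i s v, (x i).2.b s v ≤ q.eval (x i).1.n) : Computes e fun i => (x i).2.answer := by
  have hn := range_vertices hx.rep
  have hsol := stages_solution q hx hb
  have hw : Computes e fun i =>
      encList encNat (((x i).2.stages.solution (numSubsets r)).headD []) :=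
    hsol.fst.congr fun i => by cases (x i).2.stages.solution (numSubsets r) <;> rfl
  refine hsol.ifNil (const .nil) ((const (.num 1)).pair ?_)
  refine ofFn (n := fun _ => r) (range_const r) fun φ j he hj => ?_
  refine ofFn (hn.lift he) fun ψ v he' hv => ?_
  refine (Decides.mem_typeAt (const (encNat 0)) ((hw.lift he).lift he') hv
    (hj.lift he')).ofProp.congr fun y => ?_
  simp [Instance.setsOf]

end

theorem frameworkProblem_polyTimeSolvable (k r p : ℕ) (q : Polynomial ℕ) :
    (frameworkProblem k r p q).PolyTimeSolvable := by
  obtain ⟨P, hP, T, hT⟩ := Computes.answer (e := (frameworkProblem k r p q).encInst)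
    (x := fun x => x.1) q .id fun x => x.2
  refine ⟨P, T, fun x => ⟨hT x, ?_⟩⟩
  rw [hP]
  rcases x.1.2.solution_spec with ⟨h, hn⟩ | ⟨w, h, hopt⟩
  · exact Or.inr ⟨hn, by simp [Instance.answer, h]⟩
  · exact Or.inl ⟨_, hopt, by simp [Instance.answer, h, frameworkProblem]⟩

/-! ### List matrix partitions and colourings as instances of the framework -/

/-- A search problem is solvable in polynomial time if its instances can be translated, in
polynomial time, to instances of a solvable problem with the same encodings of solutions. -/
theorem SearchProblem.PolyTimeSolvable.of_reduction {Q Q' : SearchProblem}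
    (h : Q'.PolyTimeSolvable) (red : Q.Inst → Q'.Inst)
    (hred : Computes Q.encInst fun x => Q'.encInst (red x))
    (hsol : ∀ x y', Q'.IsSol (red x) y' →
      ∃ y, Q.IsSol x y ∧ Q.encCand x y = Q'.encCand (red x) y')
    (hno : ∀ x y, Q.IsSol x y → ∃ y', Q'.IsSol (red x) y') : Q.PolyTimeSolvable := by
  obtain ⟨P, T, hP⟩ := h
  have h1 : Computes (fun x => Q'.encInst (red x)) fun x => P.run (Q'.encInst (red x)) :=
    ⟨P, fun _ => rfl, T, fun x => (hP (red x)).1⟩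
  obtain ⟨P', hP', T', hT'⟩ := hred.trans h1
  refine ⟨P', T', fun x => ⟨hT' x, ?_⟩⟩
  rw [hP']
  rcases (hP (red x)).2 with ⟨y', hy', hrun⟩ | ⟨hn, hrun⟩
  · obtain ⟨y, hy, henc⟩ := hsol x y' hy'
    exact Or.inl ⟨y, hy, henc ▸ hrun⟩
  · refine Or.inr ⟨fun y hy => ?_, hrun⟩
    obtain ⟨y', hy'⟩ := hno x y hy
    exact hn y' hy'

section ListMatrix

variable {k m : ℕ} {R : ThinRep k}

/-- The instance of the framework for a list matrix partition problem: the list of a vertex consists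
of the singletons `{j}` for the parts `j` on the given list. -/
noncomputable def ListMatrix.toInstance (P : ListMatrix R m) (O : Objective R m) :
    Instance R m 0 where
  toObjective := O
  b := fun s => s.elim0
  L v := (P.L v).image fun j => {j}
  M := P.M
  M_symm := P.M_symm
  lowerInter := fun s => s.elim0
  upperInter := fun s => s.elim0
  lowerUnion := fun s => s.elim0
  upperUnion := fun s => s.elim0

theorem filter_mem_parts {n : ℕ} (f : Fin n → Fin m) (v : Fin n) :
    (Finset.univ.filter fun j => v ∈ parts f j) = {f v} := by
  ext j
  simp [parts, eq_comm]

theorem ListMatrix.feasible_toInstance (P : ListMatrix R m) (O : Objective R m)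
    (S : Fin m → Finset (Fin R.n)) :
    (P.toInstance O).Feasible S ↔ ∃ f : Fin R.n → Fin m, P.IsPartition f ∧ S = parts f := by
  constructor
  · rintro ⟨h1, h2, _, _⟩
    have h (v) : ∃ j ∈ P.L v, (Finset.univ.filter fun j => v ∈ S j) = {j} := by
      obtain ⟨j, hj, h⟩ := Finset.mem_image.1 (h1 v)
      exact ⟨j, hj, h.symm⟩
    choose f hf hS using h
    have hSf : S = parts f := by
      funext j
      ext v
      have := congrArg (j ∈ ·) (hS v)
      simpa [parts, eq_comm (a := j)] using this
    exact ⟨f, ⟨hf, hSf ▸ h2⟩, hSf⟩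
  · rintro ⟨f, ⟨hf, hM⟩, rfl⟩
    refine ⟨fun v => ?_, hM, fun s => s.elim0, fun s => s.elim0⟩
    rw [filter_mem_parts]
    exact Finset.mem_image_of_mem _ (hf v)

/-- The objective without weight functions. -/
def Objective.trivial (R : ThinRep k) (m : ℕ) : Objective R m where
  t := 0
  w := fun s => s.elim0
  w_nonneg := fun s => s.elim0
  c := fun s => s.elim0
  maximize := false

theorem Objective.value_trivial (S : Fin m → Finset (Fin R.n)) :
    (Objective.trivial R m).value S = 0 :=
  Fin.sum_univ_zero _

end ListMatrix

theorem listMatrixProblem_polyTimeSolvable (k m : ℕ) :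
    (listMatrixProblem k m).PolyTimeSolvable := by
  refine (frameworkProblem_polyTimeSolvable k m 0 0).of_reduction
    (fun x => ⟨⟨x.1, x.2.toInstance (.trivial x.1 m)⟩, fun s => s.elim0⟩) ?_ ?_ ?_
  · have hx : Computes (listMatrixProblem k m).encInst fun x =>
        .ofList [x.1.enc, encMatrix x.2.M, .ofFn fun v => .ofSet (x.2.L v)] := .id
    have hL : Computes (listMatrixProblem k m).encInst fun x =>
        .ofFn fun v => .ofFamily fun J => .ofProp (J ∈ (x.2.toInstance (.trivial x.1 m)).L v) := by
      refine .ofFn (Computes.range_vertices hx.fst) fun φ v he hv => ?_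
      refine .ofFamily fun ψ a he' ha => ?_
      have h1 := Computes.getD_ofFn (f := fun x v => Data.ofSet ((φ x).2.L v))
        (hx.lift he).snd.snd.fst hv
      refine Decides.ofProp ((Computes.exists_fin (n := fun _ => m)
        (P := fun y j => j ∈ (φ (ψ y)).2.L (v (ψ y)) ∧ subsetAt m (a y) = {j})
        (.range_const m) fun χ j he'' hj => ?_).congr fun y => ?_)
      · refine (Decides.of_ofProp (Computes.getD_ofFn (n := fun _ => m)
          (f := fun z j => Data.ofProp (j ∈ (φ (ψ (χ z))).2.L (v (ψ (χ z)))))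
          ((h1.lift he').lift he'') hj)).and ?_
        refine (Decides.of_bounded (m := numSubsets m) (m' := m)
          (P := fun a j => ∃ h : j < m, subsetAt m a = {⟨j, h⟩}) ?_ (ha.lift he'') hj).congr
          fun z => by simp
        rintro a j ⟨h, h'⟩
        exact ⟨lt_numSubsets_of_mem (j := ⟨j, h⟩) (by simp [h']), h⟩
      · simp [ListMatrix.toInstance, eq_comm]
    refine (hx.fst.pair ((Computes.const .nil).pair ((Computes.const .nil).pair
      ((Computes.const (.num 0)).pair ((Computes.const .nil).pair (hL.pair
      (hx.snd.fst.pair (Computes.const (.ofList [.nil, .nil, .nil, .nil]))))))))).congr fun x => ?_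
    simp [frameworkProblem, Instance.enc, Data.ofList, Data.ofFn, ListMatrix.toInstance,
      Objective.trivial, Data.ofProp, Data.fst, Data.snd]
  · rintro ⟨R, P⟩ S ⟨hS, _⟩
    obtain ⟨f, hf, rfl⟩ := (P.feasible_toInstance _ S).1 hS
    exact ⟨f, hf, rfl⟩
  · rintro ⟨R, P⟩ f hf
    refine ⟨parts f, (P.feasible_toInstance _ _).2 ⟨f, hf, rfl⟩, fun S' _ => ?_⟩
    have h0 (S) : (P.toInstance (.trivial R m)).value S = 0 := Objective.value_trivial S
    split_ifs <;> exact le_of_eq ((h0 _).trans (h0 _).symm)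

section Colouring

variable {k : ℕ}

/-- Colouring as a list matrix partition problem: all parts are stable, and there are no further
restrictions. -/
def ThinRep.colouring (R : ThinRep k) (s : ℕ) : ListMatrix R s where
  M := fun i j => if i = j then .zero else .star
  M_symm := Matrix.IsSymm.ext fun i j => by simp [eq_comm]
  L _ := Finset.univ

theorem ThinRep.isPartition_colouring {s : ℕ} (R : ThinRep k) (f : Fin R.n → Fin s) :
    (R.colouring s).IsPartition f ↔ ∀ u v, R.G.Adj u v → f u ≠ f v := by
  constructor
  · rintro ⟨_, h⟩ u v huv he
    exact (h (f u) (f u)).2 (by simp [colouring]) u (by simp [parts]) v (by simp [parts, he]) huv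
  · intro h
    refine ⟨fun v => Finset.mem_univ _, fun i j => ⟨fun hM => ?_, fun hM u hu v hv huv => ?_⟩⟩
    · simp only [colouring] at hM
      split_ifs at hM
    · have hij : i = j := by
        by_contra hne
        simp [colouring, hne] at hM
      simp only [parts, Finset.mem_filter, Finset.mem_univ, true_and] at hu hv
      exact h u v huv (hu.trans (hij.trans hv.symm))

theorem ThinRep.exists_isPartition_colouring {s : ℕ} (R : ThinRep k)
    (S : Fin s → Finset (Fin R.n)) :
    (∃ f : Fin R.n → Fin s, (R.colouring s).IsPartition f ∧ S = parts f) ↔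
      ∃ C : R.G.Coloring (Fin s), S = parts fun v => C v := by
  simp only [isPartition_colouring]
  constructor
  · rintro ⟨f, hf, rfl⟩
    exact ⟨SimpleGraph.Coloring.mk f fun {u v} h => hf u v h, rfl⟩
  · rintro ⟨C, rfl⟩
    exact ⟨fun v => C v, fun u v h => C.valid h, rfl⟩

end Colouring

theorem colouringProblem_polyTimeSolvable (k s : ℕ) : (colouringProblem k s).PolyTimeSolvable := by
  refine (listMatrixProblem_polyTimeSolvable k s).of_reduction
    (fun R => ⟨R, R.colouring s⟩) ?_ ?_ ?_
  · have hR : Computes (colouringProblem k s).encInst fun R => R.enc := .id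
    have hL : Computes (colouringProblem k s).encInst fun R =>
        .ofFn fun v : Fin R.n => .ofSet ((R.colouring s).L v) :=
      .ofFn (Computes.range_vertices hR) fun _ _ _ _ =>
        .const (.ofSet (Finset.univ : Finset (Fin s)))
    exact hR.pair ((Computes.const (encMatrix fun i j : Fin s =>
      if i = j then Entry.zero else Entry.star)).pair (hL.pair (.const .nil)))
  · intro R f hf
    obtain ⟨C, hC⟩ := (R.exists_isPartition_colouring (parts f)).1 ⟨f, hf, rfl⟩
    exact ⟨C, trivial, congrArg encSets hC.symm⟩
  · intro R C _
    obtain ⟨f, hf, _⟩ := (R.exists_isPartition_colouring _).2 ⟨C, rfl⟩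
    exact ⟨f, hf⟩

end Thin

open Thin in
theorem mainTheorem1 :
    (∀ (k r p : ℕ) (q : Polynomial ℕ), (frameworkProblem k r p q).PolyTimeSolvable) ∧
    (∀ (k m : ℕ),
      (∀ (R : ThinRep k) (O : Objective R m) (P : ListMatrix R m),
        ∃ I : Instance R m 0, I.toObjective = O ∧
          ∀ S : Fin m → Finset (Fin R.n),
            I.Feasible S ↔ ∃ f : Fin R.n → Fin m, P.IsPartition f ∧ S = parts f) ∧
      (listMatrixProblem k m).PolyTimeSolvable) ∧
    (∀ (k s : ℕ),
      (∀ (R : ThinRep k) (O : Objective R s),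
        ∃ I : Instance R s 0, I.toObjective = O ∧
          ∀ S : Fin s → Finset (Fin R.n),
            I.Feasible S ↔ ∃ C : R.G.Coloring (Fin s), S = parts fun v => C v) ∧
      (colouringProblem k s).PolyTimeSolvable) :=
  ⟨frameworkProblem_polyTimeSolvable, fun k m =>
    ⟨fun _ O P => ⟨P.toInstance O, rfl, P.feasible_toInstance O⟩,
      listMatrixProblem_polyTimeSolvable k m⟩, fun k s =>
    ⟨fun R O => ⟨(R.colouring s).toInstance O, rfl, fun S =>
      ((R.colouring s).feasible_toInstance O S).trans (R.exists_isPartition_colouring S)⟩,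
      colouringProblem_polyTimeSolvable k s⟩⟩
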